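/- Terminology. A ($\Lambda$-labelled) graph is a finite connected simple undirected graph with at least three nodes, each carrying a label from the finite alphabet $\Lambda$; its label count $L_G:\Lambda\to\mathbb N$ gives the number of nodes with each label. A distributed machine consists of a finite set $Q$ of states, a counting bound $\beta\ge 1$, an initialisation function $\delta_0:\Lambda\to Q$, a transition function $\delta: Q\times\{0,\dots,\beta\}^Q\to Q$, and disjoint sets $Y,N\subseteq Q$ of accepting and rejecting states. A node labelled $\gamma$ starts in state $\delta_0(\gamma)$; a selected node moves from its state $q$ to $\delta(q,\mathcal N)$, where $\mathcal N(r)$ is the number of its neighbours in state $r$, cut off at $\beta$; the other nodes stay idle. A run is accepting (rejecting) if from some time on all nodes are in states of $Y$ (of $N$). A DAf-automaton is such a machine (counting, with acceptance by stable consensus) with the adversarial scheduler: exactly one node is selected at each step, and the fair schedules are all those that select every node infinitely often. It is required that, for every input graph $G$ of the class considered, either all fair runs on $G$ are accepting ($G$ is accepted) or all fair runs on $G$ are rejecting ($G$ is rejected). It decides a predicate $\varphi:\mathbb N^l\to\{0,1\}$ on a class of graphs labelled over $\Lambda=\{x_1,\dots,x_l\}$ if it accepts a graph $G$ of the class exactly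 when $\varphi(L_G(x_1),\dots,L_G(x_l))=1$. Proposition. Let $a_1,\dots,a_l\in\mathbb Z$ and let $\varphi:\mathbb N^l\to\{0,1\}$ be the homogeneous threshold predicate $\varphi(x_1,\dots,x_l)=1\iff a_1x_1+\dots+a_lx_l\ge 0$ (for instance majority, $x_1-x_2\ge 0$). Then for every $k\in\mathbb N$ there is a DAf-automaton that decides $\varphi$ on the class of all graphs of maximum degree at most $k$. -/

import Mathlib

universe u

/-- A `Λ`-labelled undirected graph (a communication network): finite, without loops or multiple
edges, connected, and with at least three nodes. -/
structure LabelledGraph (Λ : Type) where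
  /-- the nodes -/
  V : Type u
  /-- the edges -/
  graph : SimpleGraph V
  /-- the labelling -/
  label : V → Λ
  finite_nodes : Finite V
  three_le_card : 3 ≤ Nat.card V
  connected : graph.Connected

namespace LabelledGraph

variable {Λ : Type}

/-- The label count `L_G : Λ → ℕ`: the number of nodes carrying a given label. -/
noncomputable def labelCount (G : LabelledGraph.{u} Λ) (x : Λ) : ℕ :=
  {v : G.V | G.label v = x}.ncard

/-- The graphs in which every node has at most `k` neighbours. -/
def degreeBounded (Λ : Type) (k : ℕ) : Set (LabelledGraph.{u} Λ) :=
  {G | ∀ v : G.V, (G.graph.neighborSet v).ncard ≤ k}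

end LabelledGraph

/-- A distributed machine with input alphabet `Λ`. Every counting bound `bound ≥ 1` is allowed
(counting), and nodes may leave accepting and rejecting states (stable consensus). -/
structure DistributedMachine (Λ : Type) where
  /-- the states -/
  State : Type
  finite_state : Finite State
  /-- the counting bound `β` -/
  bound : ℕ
  one_le_bound : 1 ≤ bound
  /-- the initialisation function -/
  init : Λ → State
  /-- the transition function; its second argument takes values in `{0, …, β}` -/
  trans : State → (State → Fin (bound + 1)) → State
  /-- the accepting states -/
  accepting : Set State
  /-- the rejecting states -/
  rejecting : Set State
  disjoint : Disjoint accepting rejecting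

namespace DistributedMachine

variable {Λ : Type} (M : DistributedMachine Λ) (G : LabelledGraph.{u} Λ)

/-- The neighbourhood function of `v` at the configuration `C`: the number of neighbours of `v` in
each state, cut off at the counting bound. -/
noncomputable def neighbourhood (C : G.V → M.State) (v : G.V) (q : M.State) : Fin (M.bound + 1) :=
  ⟨min {w : G.V | G.graph.Adj v w ∧ C w = q}.ncard M.bound, Nat.lt_succ_of_le (min_le_right _ _)⟩

open Classical in
/-- The successor of the configuration `C` via the selection `S`. -/
noncomputable def succ (C : G.V → M.State) (S : Set G.V) : G.V → M.State :=
  fun v => if v ∈ S then M.trans (C v) (M.neighbourhood G C v) else C v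

/-- The run of `M` on `G` scheduled by `σ`. -/
noncomputable def run (σ : ℕ → Set G.V) : ℕ → G.V → M.State
  | 0 => fun v => M.init (G.label v)
  | t + 1 => M.succ G (run σ t) (σ t)

/-- The run scheduled by `σ` is accepting: from some time on all nodes are in accepting states. -/
def AcceptingRun (σ : ℕ → Set G.V) : Prop :=
  ∃ t, ∀ t' ≥ t, ∀ v, M.run G σ t' v ∈ M.accepting

/-- The run scheduled by `σ` is rejecting: from some time on all nodes are in rejecting states. -/
def RejectingRun (σ : ℕ → Set G.V) : Prop :=
  ∃ t, ∀ t' ≥ t, ∀ v, M.run G σ t' v ∈ M.rejecting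

end DistributedMachine

/-- A scheduler: a selection constraint, given by the permitted selections of each graph, and a
fairness constraint, given by the fair schedules of each graph. In a schedule, every node is
selected infinitely often. -/
structure Scheduler (Λ : Type) where
  /-- the permitted selections -/
  selections : (G : LabelledGraph.{u} Λ) → Set (Set G.V)
  selections_cover : ∀ (G : LabelledGraph.{u} Λ) (v : G.V), ∃ S ∈ selections G, v ∈ S
  /-- the fair schedules -/
  fair : (G : LabelledGraph.{u} Λ) → Set (ℕ → Set G.V)
  permitted_of_fair : ∀ (G : LabelledGraph.{u} Λ), ∀ σ ∈ fair G, ∀ t, σ t ∈ selections G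
  infinitely_often_of_fair : ∀ (G : LabelledGraph.{u} Λ), ∀ σ ∈ fair G, ∀ v : G.V,
    ∀ n : ℕ, ∃ t ≥ n, v ∈ σ t

namespace Scheduler

variable {Λ : Type}

/-- Exclusive selection: at each step exactly one node makes a move. -/
def IsExclusive (s : Scheduler.{u} Λ) : Prop :=
  ∀ G : LabelledGraph.{u} Λ, s.selections G = {S | ∃ v : G.V, S = {v}}

/-- Adversarial scheduling: every sequence of permitted selections that selects every node
infinitely often is fair. -/
def IsAdversarial (s : Scheduler.{u} Λ) : Prop :=
  ∀ (G : LabelledGraph.{u} Λ) (σ : ℕ → Set G.V), (∀ t, σ t ∈ s.selections G) →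
    (∀ v : G.V, ∀ n : ℕ, ∃ t ≥ n, v ∈ σ t) → σ ∈ s.fair G

end Scheduler

/-- A distributed automaton on the class `𝒢` of graphs: a machine and a scheduler satisfying the
consistency condition on every graph of the class. -/
structure DistributedAutomaton {Λ : Type} (𝒢 : Set (LabelledGraph.{u} Λ)) where
  /-- the machine -/
  machine : DistributedMachine Λ
  /-- the scheduler -/
  scheduler : Scheduler.{u} Λ
  consistent : ∀ G ∈ 𝒢, (∀ σ ∈ scheduler.fair G, machine.AcceptingRun G σ) ∨
    (∀ σ ∈ scheduler.fair G, machine.RejectingRun G σ)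

namespace DistributedAutomaton

variable {Λ : Type} {𝒢 : Set (LabelledGraph.{u} Λ)}

/-- `A` accepts `G` if some fair run of `A` on `G` is accepting. -/
def Accepts (A : DistributedAutomaton 𝒢) (G : LabelledGraph.{u} Λ) : Prop :=
  ∃ σ ∈ A.scheduler.fair G, A.machine.AcceptingRun G σ

/-- The class DAf: counting, acceptance by stable consensus (neither restricts the machine
further), and adversarial scheduling; selection is exclusive. -/
def IsDAf (A : DistributedAutomaton 𝒢) : Prop :=
  A.scheduler.IsExclusive ∧ A.scheduler.IsAdversarial

/-- `A` decides, on the graphs of the class, the labelling property given by the predicate `φ` on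
label counts. -/
def Decides (A : DistributedAutomaton 𝒢) (φ : (Λ → ℕ) → Prop) : Prop :=
  ∀ G ∈ 𝒢, A.Accepts G ↔ φ G.labelCount

end DistributedAutomaton

/-!
The automaton is obtained in two layers: a deterministic synchronous algorithm with leaders, and
its simulation under adversarial exclusive scheduling.

*Averaging.* The synchronous algorithm decides whether `S = ∑ v, a (label v)` is negative. Every
node holds an amount `x / 2 ^ e` with a bounded integer `x`; the exponents of neighbours differ by
at most one, so it suffices to store them modulo three. Along every edge flows the difference of
the truncated signs `sat x` of its ends, in units of the coarser end, which preserves the sum `S`.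
A node with `sat x = 0` none of whose neighbours has a smaller exponent doubles its precision. If
`S ≠ 0`, the exponents are bounded, since the sum of the bounded values in ever smaller units cannot
remain equal to `S`; a node with the smallest final exponent is then saturated for ever. A
permanently saturated node only ever gives, so eventually its neighbours must be saturated with the
same sign, and so on throughout the graph. Hence, if `S < 0`, eventually `sat x = -1` everywhere
(`eventually_sat_of_sum_neg`). Conversely, negative saturation observed along a slanted cut of
space-time persists, which proves `S < 0` (`sum_neg_of_cut`).

*Detection.* Such cuts are observed by leaders. Every node learns its distance to the nearest
leader, again modulo three, and the conjunction of the observations flows up to the leaders along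
decreasing distances (`down`). A leader that finds it true raises the alarm, which flows back down
(`alarm`). If all leaders raise the alarm simultaneously, then `S < 0`
(`sum_neg_of_leaders_down`). If they raise it at different times, or some never do, then two
neighbours notice the discrepancy, and those of the leaders concerned that were early are refuted;
the leaders that are last never are (`exists_leader_not_refuted`). So either some leader, but not
all of them, is refuted, or eventually the alarm is on everywhere if `S < 0` and nowhere if `S ≥ 0`
(`eventually_alarm_iff`). At the outset all nodes are leaders. Symmetric networks, in which no
single leader can emerge, are no obstacle: several leaders that always agree do no harm.

*Simulation.* Nodes carry a clock consisting of an epoch and a phase, both modulo three, and move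
only if no neighbour is behind. Within an epoch this simulates a synchronous run step by step. A
refuted leader opens a new epoch, in which the synchronous run starts afresh without this leader.
Every epoch has a leader (`exists_leaderOf`) and each new epoch costs one
(`ncard_leaderOf_add_epoch_le`), so there is a last epoch. In it no leader is refuted, and the
outcome is correct (`eventually_good`).
-/

namespace HomogeneousThreshold

/-! ### A local averaging process with growing precision -/

open Classical in
/-- The neighbours of `v`, as a finite set. -/
noncomputable def nbrs {V : Type*} [Fintype V] (G : SimpleGraph V) (v : V) : Finset V :=
  Finset.univ.filter (G.Adj v)

@[simp] theorem mem_nbrs {V : Type*} [Fintype V] {G : SimpleGraph V} {v u : V} :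
    u ∈ nbrs G v ↔ G.Adj v u := by
  simp [nbrs]

/-- Finitely many bounded monotone sequences of natural numbers are eventually constant. -/
theorem exists_forall_eq_of_monotone {ι : Type*} [Finite ι] {f : ι → ℕ → ℕ}
    (hf : ∀ i, Monotone (f i)) (hb : ∀ i, ∃ M, ∀ t, f i t ≤ M) :
    ∃ T, ∀ t ≥ T, ∀ i, f i t = f i T := by
  cases nonempty_fintype ι
  choose M hM using hb
  obtain ⟨T, hT⟩ := WellFoundedLT.antitone_chain_condition (f := fun t => ∑ i, (M i - f i t))
    fun s t hst => Finset.sum_le_sum fun i _ => Nat.sub_le_sub_left (hf i hst) _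
  refine ⟨T, fun t ht i => ?_⟩
  have hle : ∀ i ∈ Finset.univ, M i - f i t ≤ M i - f i T := fun i _ =>
    Nat.sub_le_sub_left (hf i ht) _
  have := (Finset.sum_eq_sum_iff_of_le hle).1 (hT t ht).symm i (Finset.mem_univ i)
  have h1 := hM i t
  have h2 := hM i T
  omega

/-- The sign of `x`, with all `x` of absolute value at most `2 * k` counted as zero. -/
def sat (k : ℕ) (x : ℤ) : ℤ := if 2 * (k : ℤ) < x then 1 else if x < -(2 * (k : ℤ)) then -1 else 0

theorem sat_cases (k : ℕ) (x : ℤ) :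
    (2 * (k : ℤ) < x ∧ sat k x = 1) ∨ (x < -(2 * (k : ℤ)) ∧ sat k x = -1) ∨
      (-(2 * (k : ℤ)) ≤ x ∧ x ≤ 2 * (k : ℤ) ∧ sat k x = 0) := by
  unfold sat
  split_ifs <;> omega

theorem sat_eq_neg_one {k : ℕ} {x : ℤ} : sat k x = -1 ↔ x < -(2 * (k : ℤ)) := by
  rcases sat_cases k x with h | h | h <;> omega

theorem abs_sat_le (k : ℕ) (x : ℤ) : -1 ≤ sat k x ∧ sat k x ≤ 1 := by
  rcases sat_cases k x with h | h | h <;> omega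

section Diffusion

variable {V : Type*} [Fintype V] (G : SimpleGraph V) (k : ℕ)

/-- What `v` receives from its neighbours in one step, in units of `v`. A node holding the pair
`(x, e)` owns the amount `x / 2 ^ e`. Along each edge flows `sat` of one end minus `sat` of the
other end, in units of the coarser end. -/
noncomputable def inflow (C : V → ℤ × ℕ) (v : V) : ℤ :=
  ∑ u ∈ nbrs G v, (if (C u).2 < (C v).2 then 2 else 1) * (sat k (C u).1 - sat k (C v).1)

/-- A node refines its unit when its value is small and no neighbour has a coarser unit. -/
def Refines (C : V → ℤ × ℕ) (v : V) : Prop :=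
  sat k (C v).1 = 0 ∧ ∀ u, G.Adj v u → (C v).2 ≤ (C u).2

open Classical in
/-- One synchronous step of the averaging process. -/
noncomputable def diffuse (C : V → ℤ × ℕ) (v : V) : ℤ × ℕ :=
  if Refines G k C v then (2 * ((C v).1 + inflow G k C v), (C v).2 + 1)
  else ((C v).1 + inflow G k C v, (C v).2)

/-- The averaging process with initial values `x₀`. -/
noncomputable def diffusion (x₀ : V → ℤ) : ℕ → V → ℤ × ℕ
  | 0 => fun v => (x₀ v, 0)
  | t + 1 => diffuse G k (diffusion x₀ t)

variable {G k}

theorem inflow_bounds (hk : ∀ v, (nbrs G v).card ≤ k) (C : V → ℤ × ℕ) (v : V) :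
    2 * (k : ℤ) * (-1 - sat k (C v).1) ≤ inflow G k C v ∧
      inflow G k C v ≤ 2 * (k : ℤ) * (1 - sat k (C v).1) := by
  have hs := abs_sat_le k (C v).1
  have hc : ((nbrs G v).card : ℤ) ≤ k := by exact_mod_cast hk v
  constructor
  · have h1 : (nbrs G v).card • (2 * (-1 - sat k (C v).1)) ≤ inflow G k C v := by
      refine Finset.card_nsmul_le_sum _ _ _ fun u _ => ?_
      have := abs_sat_le k (C u).1
      split_ifs <;> omega
    rw [nsmul_eq_mul] at h1
    nlinarith
  · have h1 : inflow G k C v ≤ (nbrs G v).card • (2 * (1 - sat k (C v).1)) := by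
      refine Finset.sum_le_card_nsmul _ _ _ fun u _ => ?_
      have := abs_sat_le k (C u).1
      split_ifs <;> omega
    rw [nsmul_eq_mul] at h1
    nlinarith

theorem diffuse_of_sat_ne_zero {C : V → ℤ × ℕ} {v : V} (h : sat k (C v).1 ≠ 0) :
    diffuse G k C v = ((C v).1 + inflow G k C v, (C v).2) := by
  rw [diffuse, if_neg fun hr => h hr.1]

/-- The values stay bounded, so finitely many states suffice to store them. -/
theorem abs_diffuse_le (hk : ∀ v, (nbrs G v).card ≤ k) {B : ℕ} (hB : 8 * k ≤ B) {C : V → ℤ × ℕ}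
    {v : V} (h : -(B : ℤ) ≤ (C v).1 ∧ (C v).1 ≤ B) :
    -(B : ℤ) ≤ (diffuse G k C v).1 ∧ (diffuse G k C v).1 ≤ B := by
  have hb := inflow_bounds hk C v
  zify at hB
  rcases sat_cases k (C v).1 with hs | hs | hs
  · rw [diffuse_of_sat_ne_zero (by omega)]
    rw [hs.2] at hb
    constructor <;> dsimp only <;> linarith
  · rw [diffuse_of_sat_ne_zero (by omega)]
    rw [hs.2] at hb
    constructor <;> dsimp only <;> linarith
  · rw [hs.2.2] at hb
    unfold diffuse
    split_ifs <;> constructor <;> dsimp only <;> linarith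

theorem abs_diffusion_le (hk : ∀ v, (nbrs G v).card ≤ k) {B : ℕ} (hB : 8 * k ≤ B) {x₀ : V → ℤ}
    (h₀ : ∀ v, -(B : ℤ) ≤ x₀ v ∧ x₀ v ≤ B) (t : ℕ) (v : V) :
    -(B : ℤ) ≤ (diffusion G k x₀ t v).1 ∧ (diffusion G k x₀ t v).1 ≤ B := by
  induction t with
  | zero => exact h₀ v
  | succ t ih => exact abs_diffuse_le hk hB ih

/-- A saturated value may become small, but does not change its sign in one step. -/
theorem sat_diffuse (hk : ∀ v, (nbrs G v).card ≤ k) {C : V → ℤ × ℕ} {v : V}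
    (h : sat k (C v).1 ≠ 0) (h' : sat k (diffuse G k C v).1 ≠ 0) :
    sat k (diffuse G k C v).1 = sat k (C v).1 := by
  have hb := inflow_bounds hk C v
  rw [diffuse_of_sat_ne_zero h] at h' ⊢
  dsimp only at h' ⊢
  rcases sat_cases k (C v).1 with hs | hs | hs
  · rw [hs.2] at hb
    rcases sat_cases k ((C v).1 + inflow G k C v) with hs' | hs' | hs' <;> omega
  · rw [hs.2] at hb
    rcases sat_cases k ((C v).1 + inflow G k C v) with hs' | hs' | hs' <;> omega
  · omega

theorem exp_diffuse (C : V → ℤ × ℕ) (v : V) :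
    (C v).2 ≤ (diffuse G k C v).2 ∧ (diffuse G k C v).2 ≤ (C v).2 + 1 := by
  unfold diffuse
  split_ifs <;> simp

/-- Adjacent nodes have exponents that differ by at most one. -/
theorem exp_diffusion_le (x₀ : V → ℤ) (t : ℕ) {u v : V} (h : G.Adj v u) :
    (diffusion G k x₀ t v).2 ≤ (diffusion G k x₀ t u).2 + 1 := by
  induction t with
  | zero => simp [diffusion]
  | succ t ih =>
    have hu := (exp_diffuse (G := G) (k := k) (diffusion G k x₀ t) u).1
    simp only [diffusion]
    by_cases hr : Refines G k (diffusion G k x₀ t) v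
    · have := hr.2 u h
      rw [diffuse, if_pos hr]
      dsimp only
      omega
    · rw [diffuse, if_neg hr]
      dsimp only
      omega

theorem monotone_exp_diffusion (x₀ : V → ℤ) (v : V) :
    Monotone fun t => (diffusion G k x₀ t v).2 :=
  monotone_nat_of_le_succ fun _ => (exp_diffuse _ v).1

open Classical in
theorem sum_diffusion (x₀ : V → ℤ) (t : ℕ) :
    ∑ v, ((diffusion G k x₀ t v).1 : ℚ) / 2 ^ (diffusion G k x₀ t v).2 = ∑ v, (x₀ v : ℚ) := by
  induction t with
  | zero => simp [diffusion]
  | succ t ih =>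
    rw [← ih]
    set C := diffusion G k x₀ t with hC
    have hE : ∀ u v, G.Adj v u → (C v).2 ≤ (C u).2 + 1 := fun u v h => exp_diffusion_le x₀ t h
    have hstep : ∀ v, ((diffuse G k C v).1 : ℚ) / 2 ^ (diffuse G k C v).2 =
        ((C v).1 : ℚ) / 2 ^ (C v).2 + (inflow G k C v : ℚ) / 2 ^ (C v).2 := by
      intro v
      unfold diffuse
      split_ifs
      · push_cast
        rw [pow_succ]
        field_simp
      · push_cast
        field_simp
    have hflow : ∀ v, (inflow G k C v : ℚ) / 2 ^ (C v).2 =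
        ∑ u, (if G.Adj v u then 1 / 2 ^ min (C v).2 (C u).2 else 0) *
          ((sat k (C u).1 : ℚ) - sat k (C v).1) := by
      intro v
      rw [inflow, nbrs, Finset.sum_filter]
      push_cast
      rw [Finset.sum_div]
      refine Finset.sum_congr rfl fun u _ => ?_
      by_cases h : G.Adj v u
      · rw [if_pos h, if_pos h]
        have h1 := hE u v h
        by_cases h2 : (C u).2 < (C v).2
        · rw [if_pos h2, min_eq_right h2.le, show (C v).2 = (C u).2 + 1 by omega, pow_succ]
          field_simp
        · rw [if_neg h2, min_eq_left (by omega)]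
          ring
      · rw [if_neg h, if_neg h]
        simp
    show ∑ v, ((diffuse G k C v).1 : ℚ) / 2 ^ (diffuse G k C v).2 = _
    rw [Finset.sum_congr rfl fun v _ => hstep v, Finset.sum_add_distrib, add_eq_left,
      Finset.sum_congr rfl fun v _ => hflow v]
    -- the flows along an edge in its two directions cancel
    have hanti : ∀ f : V → V → ℚ, (∀ u v, f u v = -f v u) → ∑ v, ∑ u, f v u = 0 := by
      intro f hf
      have h1 : ∑ v, ∑ u, f v u = -∑ v, ∑ u, f v u := by
        conv_lhs => rw [Finset.sum_comm]
        simp_rw [← Finset.sum_neg_distrib]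
        exact Finset.sum_congr rfl fun u _ => Finset.sum_congr rfl fun v _ => hf v u
      linarith
    refine hanti _ fun u v => ?_
    rw [min_comm, G.adj_comm]
    ring

/-- Once every node is saturated negatively, the initial sum is known to be negative. -/
theorem sum_neg_of_forall_sat [Nonempty V] {x₀ : V → ℤ} {t : ℕ}
    (h : ∀ v, sat k (diffusion G k x₀ t v).1 = -1) : ∑ v, x₀ v < 0 := by
  have h1 := sum_diffusion (G := G) (k := k) x₀ t
  have h2 : ∑ v, ((diffusion G k x₀ t v).1 : ℚ) / 2 ^ (diffusion G k x₀ t v).2 < 0 := by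
    refine Finset.sum_neg (fun v _ => ?_) Finset.univ_nonempty
    have h3 := sat_eq_neg_one.1 (h v)
    have h4 : ((diffusion G k x₀ t v).1 : ℚ) < 0 := by
      have : (diffusion G k x₀ t v).1 < 0 := by omega
      exact_mod_cast this
    exact div_neg_of_neg_of_pos h4 (by positivity)
  rw [h1] at h2
  exact_mod_cast h2

theorem sum_pos_of_forall_sat [Nonempty V] {x₀ : V → ℤ} {t : ℕ}
    (h : ∀ v, sat k (diffusion G k x₀ t v).1 = 1) : 0 < ∑ v, x₀ v := by
  have h1 := sum_diffusion (G := G) (k := k) x₀ t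
  have h2 : 0 < ∑ v, ((diffusion G k x₀ t v).1 : ℚ) / 2 ^ (diffusion G k x₀ t v).2 := by
    refine Finset.sum_pos (fun v _ => ?_) Finset.univ_nonempty
    have h4 : (0 : ℚ) < ((diffusion G k x₀ t v).1 : ℚ) := by
      have : 0 < (diffusion G k x₀ t v).1 := by
        have h3 := sat_cases k (diffusion G k x₀ t v).1
        have := h v
        omega
      exact_mod_cast this
    positivity
  rw [h1] at h2
  exact_mod_cast h2

/-- A node that stays saturated exchanges nothing with its neighbours from some time on, because
its value can only shrink towards zero; its neighbours are then saturated with the same sign. -/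
theorem eventually_sat_of_adj (x₀ : V → ℤ) {ε : ℤ} (hε : ε = 1 ∨ ε = -1)
    {u v : V} (huv : G.Adj v u) (hv : ∃ T, ∀ t ≥ T, sat k (diffusion G k x₀ t v).1 = ε) :
    ∃ T, ∀ t ≥ T, sat k (diffusion G k x₀ t u).1 = ε := by
  obtain ⟨T, hT⟩ := hv
  have hstep : ∀ t ≥ T, (diffusion G k x₀ (t + 1) v).1 =
      (diffusion G k x₀ t v).1 + inflow G k (diffusion G k x₀ t) v := by
    intro t ht
    have := hT t ht
    exact congrArg Prod.fst (diffuse_of_sat_ne_zero (by omega))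
  have hterm : ∀ t ≥ T, ∀ w ∈ nbrs G v,
      (if (diffusion G k x₀ t w).2 < (diffusion G k x₀ t v).2 then (2 : ℤ) else 1) *
        (sat k (diffusion G k x₀ t w).1 - sat k (diffusion G k x₀ t v).1) * ε ≤ 0 := by
    intro t ht w _
    rw [hT t ht]
    have := abs_sat_le k (diffusion G k x₀ t w).1
    rcases hε with rfl | rfl <;> split_ifs <;> omega
  have hsum : ∀ t, inflow G k (diffusion G k x₀ t) v * ε = ∑ w ∈ nbrs G v,
      (if (diffusion G k x₀ t w).2 < (diffusion G k x₀ t v).2 then (2 : ℤ) else 1) *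
        (sat k (diffusion G k x₀ t w).1 - sat k (diffusion G k x₀ t v).1) * ε := fun t => by
    rw [inflow, Finset.sum_mul]
  have hle : ∀ t ≥ T, inflow G k (diffusion G k x₀ t) v * ε ≤ 0 := fun t ht => by
    rw [hsum]
    exact Finset.sum_nonpos (hterm t ht)
  have hpos : ∀ t ≥ T, 0 ≤ (diffusion G k x₀ t v).1 * ε := by
    intro t ht
    have h1 := hT t ht
    rcases hε with rfl | rfl <;>
      rcases sat_cases k (diffusion G k x₀ t v).1 with h | h | h <;> omega
  have hanti : Antitone fun t => ((diffusion G k x₀ (T + t) v).1 * ε).toNat := by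
    refine antitone_nat_of_succ_le fun t => ?_
    have h1 := hstep (T + t) (by omega)
    have h2 := hle (T + t) (by omega)
    have h3 : (diffusion G k x₀ (T + t + 1) v).1 * ε = (diffusion G k x₀ (T + t) v).1 * ε +
        inflow G k (diffusion G k x₀ (T + t)) v * ε := by rw [h1]; ring
    rw [← add_assoc]
    omega
  obtain ⟨n, hn⟩ := WellFoundedLT.antitone_chain_condition hanti
  refine ⟨T + n, fun t ht => ?_⟩
  obtain ⟨j, rfl⟩ := Nat.exists_eq_add_of_le (show T ≤ t by omega)
  have h1 : ((diffusion G k x₀ (T + n) v).1 * ε).toNat =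
    ((diffusion G k x₀ (T + j) v).1 * ε).toNat := hn j (by omega)
  have h2 : ((diffusion G k x₀ (T + n) v).1 * ε).toNat =
    ((diffusion G k x₀ (T + (j + 1)) v).1 * ε).toNat := hn (j + 1) (by omega)
  have h3 := hpos (T + j) (by omega)
  have h4 := hpos (T + j + 1) (by omega)
  have h5 : (diffusion G k x₀ (T + j + 1) v).1 * ε = (diffusion G k x₀ (T + j) v).1 * ε +
      inflow G k (diffusion G k x₀ (T + j)) v * ε := by rw [hstep _ (by omega)]; ring
  rw [← add_assoc] at h2
  have h6 : inflow G k (diffusion G k x₀ (T + j)) v * ε = 0 := by omega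
  rw [hsum, Finset.sum_eq_zero_iff_of_nonpos (hterm _ (by omega))] at h6
  have h7 := h6 u (mem_nbrs.2 huv)
  rw [hT _ (by omega)] at h7
  rcases hε with rfl | rfl <;> split_ifs at h7 <;> omega

/-- The invariant sum bounds the exponents, unless it vanishes. -/
theorem exp_diffusion_bounded (hG : G.Connected) (hk : ∀ v, (nbrs G v).card ≤ k) {x₀ : V → ℤ}
    (hS : ∑ v, x₀ v ≠ 0) (v : V) : ∃ M, ∀ t, (diffusion G k x₀ t v).2 ≤ M := by
  by_contra hv
  push Not at hv
  have hall : ∀ u, ∀ M, ∃ t, M < (diffusion G k x₀ t u).2 := by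
    intro u
    induction (SimpleGraph.reachable_iff_reflTransGen v u).1 (hG.preconnected v u) with
    | refl => exact hv
    | tail _ hadj ih =>
      intro M
      obtain ⟨t, ht⟩ := ih (M + 1)
      have := exp_diffusion_le (k := k) x₀ t hadj
      exact ⟨t, by omega⟩
  obtain ⟨B, hB8, hB⟩ : ∃ B : ℕ, 8 * k ≤ B ∧ ∀ v, -(B : ℤ) ≤ x₀ v ∧ x₀ v ≤ B := by
    refine ⟨8 * k + ∑ v, (x₀ v).natAbs, by omega, fun v => ?_⟩
    have := Finset.single_le_sum (f := fun v => (x₀ v).natAbs) (fun _ _ => Nat.zero_le _)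
      (Finset.mem_univ v)
    omega
  obtain ⟨M, hM⟩ := pow_unbounded_of_one_lt ((Fintype.card V : ℚ) * B) (one_lt_two (α := ℚ))
  choose f hf using fun u => hall u M
  set t := ∑ u, f u with ht
  have hexp : ∀ u, M ≤ (diffusion G k x₀ t u).2 := fun u =>
    (hf u).le.trans (monotone_exp_diffusion x₀ u
      (Finset.single_le_sum (f := f) (fun _ _ => Nat.zero_le _) (Finset.mem_univ u)))
  have hlt : |∑ v, (x₀ v : ℚ)| < 1 := by
    rw [← sum_diffusion (G := G) (k := k) x₀ t]
    calc _ ≤ ∑ v, |((diffusion G k x₀ t v).1 : ℚ) / 2 ^ (diffusion G k x₀ t v).2| :=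
          Finset.abs_sum_le_sum_abs _ _
      _ ≤ ∑ _v : V, (B : ℚ) / 2 ^ M := by
          refine Finset.sum_le_sum fun u _ => ?_
          have h1 := abs_diffusion_le hk hB8 hB t u
          have h2 : |((diffusion G k x₀ t u).1 : ℚ)| ≤ B := by
            rw [abs_le]
            exact_mod_cast h1
          rw [abs_div, abs_of_pos (show (0 : ℚ) < 2 ^ (diffusion G k x₀ t u).2 by positivity)]
          exact div_le_div₀ (by positivity) h2 (by positivity)
            (pow_le_pow_right₀ (by norm_num) (hexp u))
      _ = (Fintype.card V : ℚ) * B / 2 ^ M := by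
          rw [Finset.sum_const, Finset.card_univ, nsmul_eq_mul]
          ring
      _ < 1 := by rwa [div_lt_one (by positivity)]
  have h1 : |∑ v, x₀ v| < 1 := by exact_mod_cast hlt
  exact hS (Int.abs_lt_one_iff.1 h1)

/-- If the sum is negative, all nodes are eventually saturated negatively. The nodes of the
smallest final exponent never refine again, hence they are permanently saturated, and permanent
saturation spreads along the edges. -/
theorem eventually_sat_of_sum_neg (hG : G.Connected) (hk : ∀ v, (nbrs G v).card ≤ k)
    {x₀ : V → ℤ} (hS : ∑ v, x₀ v < 0) :
    ∃ T, ∀ t ≥ T, ∀ v, sat k (diffusion G k x₀ t v).1 = -1 := by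
  have := hG.nonempty
  obtain ⟨T, hT⟩ := exists_forall_eq_of_monotone (monotone_exp_diffusion (G := G) (k := k) x₀)
    (exp_diffusion_bounded hG hk hS.ne)
  obtain ⟨m, hm⟩ := Finite.exists_min fun v => (diffusion G k x₀ T v).2
  have hsat : ∀ t ≥ T, sat k (diffusion G k x₀ t m).1 ≠ 0 := by
    intro t ht h0
    have hr : Refines G k (diffusion G k x₀ t) m :=
      ⟨h0, fun u _ => by rw [hT t ht, hT t ht]; exact hm u⟩
    have h1 := hT (t + 1) (by omega) m
    rw [← hT t ht m, diffusion, diffuse, if_pos hr] at h1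
    simp at h1
  have hperm : ∀ t ≥ T, sat k (diffusion G k x₀ t m).1 = sat k (diffusion G k x₀ T m).1 := by
    intro t ht
    induction t, ht using Nat.le_induction with
    | base => rfl
    | succ t ht ih => rw [← ih]; exact sat_diffuse hk (hsat t ht) (hsat (t + 1) (by omega))
  obtain ⟨ε, hε, hmε⟩ : ∃ ε : ℤ, (ε = 1 ∨ ε = -1) ∧ sat k (diffusion G k x₀ T m).1 = ε := by
    refine ⟨_, ?_, rfl⟩
    have := hsat T le_rfl
    have := abs_sat_le k (diffusion G k x₀ T m).1
    omega
  have hspread : ∀ v, ∃ T, ∀ t ≥ T, sat k (diffusion G k x₀ t v).1 = ε := by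
    intro v
    induction (SimpleGraph.reachable_iff_reflTransGen m v).1 (hG.preconnected m v) with
    | refl => exact ⟨T, fun t ht => (hperm t ht).trans hmε⟩
    | tail _ hadj ih => exact eventually_sat_of_adj x₀ hε hadj ih
  choose g hg using hspread
  have hall : ∀ t ≥ ∑ u, g u, ∀ v, sat k (diffusion G k x₀ t v).1 = ε := fun t ht v =>
    hg v t ((Finset.single_le_sum (f := g) (fun _ _ => Nat.zero_le _) (Finset.mem_univ v)).trans ht)
  rcases hε with rfl | rfl
  · exact absurd (sum_pos_of_forall_sat (hall _ le_rfl)) hS.not_gt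
  · exact ⟨_, hall⟩

/-- Negative saturation observed along a slanted cut `s` of space-time, at two consecutive times
at each node, persists; hence the sum is negative. -/
theorem sum_neg_of_cut [Nonempty V] {x₀ : V → ℤ} (s : V → ℕ)
    (hs : ∀ u v, G.Adj v u → s u ≤ s v + 1)
    (h : ∀ v, sat k (diffusion G k x₀ (s v) v).1 = -1)
    (h' : ∀ v, sat k (diffusion G k x₀ (s v + 1) v).1 = -1) : ∑ v, x₀ v < 0 := by
  have key : ∀ t v, s v ≤ t → sat k (diffusion G k x₀ t v).1 = -1 := by
    intro t
    induction t with
    | zero =>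
      intro v hv
      have := h v
      rwa [Nat.le_zero.1 hv] at this
    | succ t ih =>
      intro v hv
      rcases Nat.lt_or_ge t (s v) with hlt | hge
      · have := h v
        rwa [show s v = t + 1 by omega] at this
      rcases Nat.lt_or_ge (s v) t with hlt | hge'
      · have hv1 := ih v hge
        have h0 : inflow G k (diffusion G k x₀ t) v = 0 := by
          refine Finset.sum_eq_zero fun u hu => ?_
          have := hs u v (mem_nbrs.1 hu)
          rw [hv1, ih u (by omega), sub_self, mul_zero]
        rw [diffusion, diffuse_of_sat_ne_zero (by omega), h0, add_zero]
        exact hv1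
      · have := h' v
        rwa [show s v = t by omega] at this
  exact sum_neg_of_forall_sat (t := ∑ u, s u) fun v => key _ v
    (Finset.single_le_sum (f := s) (fun _ _ => Nat.zero_le _) (Finset.mem_univ v))

end Diffusion

/-! ### The synchronous algorithm -/

/-- A run of a synchronous algorithm: in each step, every node applies `f` to its own state and
the multiset of the states of its neighbours. -/
noncomputable def syncRun {V Q : Type*} [Fintype V] (G : SimpleGraph V) (f : Q → Multiset Q → Q)
    (q₀ : V → Q) : ℕ → V → Q
  | 0 => q₀
  | t + 1 => fun v => f (syncRun G f q₀ t v) ((nbrs G v).val.map (syncRun G f q₀ t))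

/-- The state of a node in the synchronous algorithm. -/
structure Cell (B : ℕ) where
  /-- the exponent of the averaging process, modulo three -/
  exp : ZMod 3
  /-- the value of the averaging process -/
  val : Set.Icc (-(B : ℤ)) (B : ℤ)
  /-- whether the node is a leader -/
  leader : Prop
  /-- the distance to the nearest leader modulo three, once it is known -/
  dist : Option (ZMod 3)
  /-- all nodes below this one have reported negative saturation -/
  down : Prop
  /-- all leaders above this one have found negative saturation -/
  alarm : Prop
  /-- the value of `alarm` one step earlier -/
  lastAlarm : Prop
  /-- some leader raises the alarm later than all the leaders above this node, or never -/
  refuted : Prop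

/-- A cell is determined by its eight components. -/
def cellEquiv (B : ℕ) : Cell B ≃ (ZMod 3 × Set.Icc (-(B : ℤ)) (B : ℤ)) × (Prop × Option (ZMod 3)) ×
    (Prop × Prop) × (Prop × Prop) where
  toFun q := ((q.exp, q.val), (q.leader, q.dist), (q.down, q.alarm), (q.lastAlarm, q.refuted))
  invFun p := ⟨p.1.1, p.1.2, p.2.1.1, p.2.1.2, p.2.2.1.1, p.2.2.1.2, p.2.2.2.1, p.2.2.2.2⟩
  left_inv _ := rfl
  right_inv _ := rfl

instance (B : ℕ) : Finite (Cell B) := Finite.of_equiv _ (cellEquiv B).symm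

section CellStep

variable (k : ℕ) {B : ℕ}

/-- The nearest integer of absolute value at most `B`. -/
def clamp (B : ℕ) (x : ℤ) : Set.Icc (-(B : ℤ)) (B : ℤ) :=
  Set.projIcc _ _ (by omega) x

theorem coe_clamp {B : ℕ} {x : ℤ} (h : -(B : ℤ) ≤ x ∧ x ≤ B) : (clamp B x : ℤ) = x := by
  rw [clamp, Set.projIcc_of_mem _ (show x ∈ Set.Icc (-(B : ℤ)) B from h)]

/-- The initial state of a node with initial value `x`. -/
noncomputable def cellInit (B : ℕ) (x : ℤ) (leader : Prop) : Cell B where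
  exp := 0
  val := clamp B x
  leader := leader
  dist := open Classical in if leader then some 0 else none
  down := False
  alarm := False
  lastAlarm := False
  refuted := False

open Classical in
/-- The exponent and the value after a step of the averaging process. -/
noncomputable def cellDiffuse (q : Cell B) (m : Multiset (Cell B)) : ZMod 3 × ℤ :=
  let x := q.val + (m.map fun r =>
    (if r.exp + 1 = q.exp then 2 else 1) * (sat k r.val - sat k q.val)).sum
  if sat k q.val = 0 ∧ ∀ r ∈ m, r.exp + 1 ≠ q.exp then (q.exp + 1, 2 * x) else (q.exp, x)

open Classical in
/-- The transition function of the synchronous algorithm. The neighbours of `q` at distance one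
more are below `q`, those at distance one less are above `q`. -/
noncomputable def cellStep (q : Cell B) (m : Multiset (Cell B)) : Cell B where
  exp := (cellDiffuse k q m).1
  val := clamp B (cellDiffuse k q m).2
  leader := q.leader
  dist :=
    if q.dist = none then
      if h : ∃ i, ∃ r ∈ m, r.dist = some i then some (h.choose + 1) else none
    else q.dist
  down := q.dist ≠ none ∧ (∀ r ∈ m, r.dist ≠ none) ∧ sat k q.val = -1 ∧
    sat k (clamp B (cellDiffuse k q m).2) = -1 ∧ ∀ r ∈ m, r.dist = q.dist.map (· + 1) → r.down
  alarm := (q.leader ∧ (q.alarm ∨ q.down)) ∨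
    (¬q.leader ∧ q.dist ≠ none ∧ ∀ r ∈ m, q.dist = r.dist.map (· + 1) → r.alarm)
  lastAlarm := q.alarm
  refuted := q.refuted ∨ ∃ r ∈ m, q.dist ≠ none ∧
    ((r.dist = q.dist ∧ q.alarm ∧ ¬r.alarm) ∨
      (r.dist = q.dist.map (· + 1) ∧ ((q.lastAlarm ∧ ¬r.alarm) ∨ r.refuted)))

end CellStep

theorem natCast_zmod_three_inj {a b : ℕ} (h : a ≤ b + 1) (h' : b ≤ a + 1) :
    (a : ZMod 3) = b ↔ a = b := by
  rw [ZMod.natCast_eq_natCast_iff']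
  omega

theorem natCast_zmod_three_succ_inj {a b : ℕ} (h : a ≤ b + 1) (h' : b ≤ a + 1) :
    (a : ZMod 3) + 1 = b ↔ a + 1 = b := by
  rw [← Nat.cast_succ, ZMod.natCast_eq_natCast_iff']
  omega

/-- `D` is the distance to the set `L` of nodes, characterised locally. -/
structure IsDistTo {V : Type*} (G : SimpleGraph V) (L : V → Prop) (D : V → ℕ) : Prop where
  eq_zero_iff : ∀ v, D v = 0 ↔ L v
  le_succ : ∀ v u, G.Adj v u → D u ≤ D v + 1
  exists_pred : ∀ v, D v ≠ 0 → ∃ u, G.Adj v u ∧ D v = D u + 1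

theorem exists_isDistTo {V : Type*} {G : SimpleGraph V} (hG : G.Connected) {L : V → Prop}
    (hL : ∃ r, L r) : ∃ D, IsDistTo G L D := by
  classical
  have hex : ∀ v, ∃ n r, L r ∧ ∃ p : G.Walk v r, p.length = n := by
    intro v
    obtain ⟨r, hr⟩ := hL
    obtain ⟨p⟩ := hG.preconnected v r
    exact ⟨_, r, hr, p, rfl⟩
  refine ⟨fun v => Nat.find (hex v), fun v => ?_, fun v u h => ?_, fun v h => ?_⟩
  · rw [Nat.find_eq_zero]
    constructor
    · rintro ⟨r, hr, p, hp⟩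
      rwa [SimpleGraph.Walk.eq_of_length_eq_zero hp]
    · exact fun h => ⟨v, h, .nil, rfl⟩
  · obtain ⟨r, hr, p, hp⟩ := Nat.find_spec (hex v)
    exact Nat.find_min' _ ⟨r, hr, .cons h.symm p, by rw [SimpleGraph.Walk.length_cons, hp]⟩
  · obtain ⟨r, hr, p, hp⟩ := Nat.find_spec (hex v)
    cases p with
    | nil => exact absurd hp.symm h
    | @cons _ u _ hadj p =>
      refine ⟨u, hadj, le_antisymm ?_ ?_⟩
      · obtain ⟨r', hr', p', hp'⟩ := Nat.find_spec (hex u)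
        exact Nat.find_min' _ ⟨r', hr', .cons hadj p', by rw [SimpleGraph.Walk.length_cons, hp']⟩
      · rw [← hp, SimpleGraph.Walk.length_cons]
        exact Nat.succ_le_succ (Nat.find_min' _ ⟨r, hr, p, rfl⟩)

section Ideal

variable {V : Type*} [Fintype V] (G : SimpleGraph V) (k B : ℕ) (x₀ : V → ℤ) (L : V → Prop)

/-- The run of the synchronous algorithm with initial values `x₀` and leaders `L`. -/
noncomputable def idealRun : ℕ → V → Cell B :=
  syncRun G (cellStep k) fun v => cellInit B (x₀ v) (L v)

theorem idealRun_succ (t : ℕ) (v : V) : idealRun G k B x₀ L (t + 1) v =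
    cellStep k (idealRun G k B x₀ L t v) ((nbrs G v).val.map (idealRun G k B x₀ L t)) := rfl

variable {G k B x₀ L}

theorem leader_idealRun (t : ℕ) (v : V) : (idealRun G k B x₀ L t v).leader ↔ L v := by
  induction t with
  | zero => rfl
  | succ t ih => rwa [idealRun_succ]

/-- The exponents, stored modulo three, and the clamped values represent the averaging process
faithfully. -/
theorem exp_val_idealRun (hk : ∀ v, (nbrs G v).card ≤ k) (hB : 8 * k ≤ B)
    (h₀ : ∀ v, -(B : ℤ) ≤ x₀ v ∧ x₀ v ≤ B) (t : ℕ) (v : V) :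
    (idealRun G k B x₀ L t v).exp = ((diffusion G k x₀ t v).2 : ZMod 3) ∧
      ((idealRun G k B x₀ L t v).val : ℤ) = (diffusion G k x₀ t v).1 := by
  induction t generalizing v with
  | zero => exact ⟨by simp [idealRun, syncRun, cellInit, diffusion], coe_clamp (h₀ v)⟩
  | succ t ih =>
    have hmod : ∀ u, G.Adj v u → ((idealRun G k B x₀ L t u).exp + 1 = (idealRun G k B x₀ L t v).exp
        ↔ (diffusion G k x₀ t u).2 < (diffusion G k x₀ t v).2) := by
      intro u hu
      have h1 := exp_diffusion_le (k := k) x₀ t hu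
      have h2 := exp_diffusion_le (k := k) x₀ t hu.symm
      rw [(ih u).1, (ih v).1, natCast_zmod_three_succ_inj h2 h1]
      omega
    have hstep : cellDiffuse k (idealRun G k B x₀ L t v)
        ((nbrs G v).val.map (idealRun G k B x₀ L t)) =
        (((diffuse G k (diffusion G k x₀ t) v).2 : ZMod 3),
          (diffuse G k (diffusion G k x₀ t) v).1) := by
      have hsum : (((nbrs G v).val.map (idealRun G k B x₀ L t)).map fun r =>
          (if r.exp + 1 = (idealRun G k B x₀ L t v).exp then (2 : ℤ) else 1) *
            (sat k r.val - sat k (idealRun G k B x₀ L t v).val)).sum =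
          inflow G k (diffusion G k x₀ t) v := by
        rw [Multiset.map_map]
        refine Finset.sum_congr rfl fun u hu => ?_
        simp only [Function.comp_apply, (ih _).2, hmod u (mem_nbrs.1 hu)]
      have href : (sat k (idealRun G k B x₀ L t v).val = 0 ∧
          ∀ r ∈ (nbrs G v).val.map (idealRun G k B x₀ L t),
            r.exp + 1 ≠ (idealRun G k B x₀ L t v).exp) ↔
          Refines G k (diffusion G k x₀ t) v := by
        rw [(ih v).2, Refines]
        refine and_congr_right fun _ => ?_
        simp only [Multiset.mem_map, Finset.mem_val, mem_nbrs, forall_exists_index, and_imp,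
          forall_apply_eq_imp_iff₂]
        refine forall₂_congr fun u hu => ?_
        rw [Ne, hmod u hu, not_lt]
      unfold cellDiffuse diffuse
      simp only [hsum]
      by_cases hr : Refines G k (diffusion G k x₀ t) v
      · rw [if_pos (href.2 hr), if_pos hr, (ih v).1, (ih v).2, Nat.cast_succ]
      · rw [if_neg (href.not.2 hr), if_neg hr, (ih v).1, (ih v).2]
    refine ⟨congrArg Prod.fst hstep, ?_⟩
    rw [idealRun_succ, cellStep, hstep]
    exact coe_clamp (abs_diffusion_le hk hB h₀ (t + 1) v)

theorem dist_idealRun {D : V → ℕ} (hD : IsDistTo G L D) (t : ℕ) (v : V) :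
    (idealRun G k B x₀ L t v).dist = if D v ≤ t then some (D v : ZMod 3) else none := by
  induction t generalizing v with
  | zero =>
    have h0 := hD.eq_zero_iff v
    by_cases h : L v
    · simp [idealRun, syncRun, cellInit, h, h0.2 h]
    · have : ¬D v ≤ 0 := fun h' => h (h0.1 (Nat.le_zero.1 h'))
      simp [idealRun, syncRun, cellInit, h, this]
  | succ t ih =>
    have hval : ∀ i : ZMod 3, (∃ r ∈ (nbrs G v).val.map (idealRun G k B x₀ L t), r.dist = some i) ↔
        ∃ u, G.Adj v u ∧ D u ≤ t ∧ (D u : ZMod 3) = i := by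
      intro i
      simp only [Multiset.mem_map, Finset.mem_val, mem_nbrs, exists_exists_and_eq_and, ih,
        Option.ite_none_right_eq_some, Option.some_inj]
    rw [idealRun_succ]
    simp only [cellStep]
    rw [ih v]
    by_cases h1 : D v ≤ t
    · simp [h1, h1.trans (Nat.le_succ t)]
    · rw [if_neg h1, if_pos rfl]
      by_cases h2 : D v ≤ t + 1
      · have hex : ∃ i, ∃ r ∈ (nbrs G v).val.map (idealRun G k B x₀ L t), r.dist = some i := by
          obtain ⟨u, hu, hDu⟩ := hD.exists_pred v (by omega)
          exact ⟨_, (hval _).2 ⟨u, hu, by omega, rfl⟩⟩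
        obtain ⟨u, hu, hut, hi⟩ := (hval _).1 hex.choose_spec
        have := hD.le_succ u v hu.symm
        rw [dif_pos hex, if_pos h2, ← hi, show D v = D u + 1 by omega, Nat.cast_succ]
      · rw [dif_neg, if_neg h2]
        rintro ⟨i, hi⟩
        obtain ⟨u, hu, hut, -⟩ := (hval i).1 hi
        have := hD.le_succ u v hu.symm
        omega

theorem dist_ne_none_iff {D : V → ℕ} (hD : IsDistTo G L D) (t : ℕ) (v : V) :
    (idealRun G k B x₀ L t v).dist ≠ none ↔ D v ≤ t := by
  rw [dist_idealRun hD]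
  split_ifs with h <;> simp [h]

theorem dist_eq_iff {D : V → ℕ} (hD : IsDistTo G L D) {t : ℕ} {u v : V}
    (h : G.Adj v u) (hv : D v ≤ t) :
    (idealRun G k B x₀ L t u).dist = (idealRun G k B x₀ L t v).dist ↔ D u = D v := by
  rw [dist_idealRun hD, dist_idealRun hD, if_pos hv]
  split_ifs with hu
  · rw [Option.some_inj, natCast_zmod_three_inj (hD.le_succ v u h) (hD.le_succ u v h.symm)]
  · simp only [false_iff]
    omega

theorem dist_eq_map_succ_iff {D : V → ℕ} (hD : IsDistTo G L D) {t : ℕ} {u v : V}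
    (h : G.Adj v u) (hv : D v ≤ t) :
    (idealRun G k B x₀ L t u).dist = (idealRun G k B x₀ L t v).dist.map (· + 1) ↔
      D u = D v + 1 ∧ D u ≤ t := by
  rw [dist_idealRun hD, dist_idealRun hD, if_pos hv, Option.map_some]
  split_ifs with hu
  · rw [Option.some_inj, eq_comm,
      natCast_zmod_three_succ_inj (hD.le_succ u v h.symm) (hD.le_succ v u h)]
    omega
  · simp [hu]

theorem down_idealRun_succ {D : V → ℕ} (hD : IsDistTo G L D)
    (hk : ∀ v, (nbrs G v).card ≤ k) (hB : 8 * k ≤ B)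
    (h₀ : ∀ v, -(B : ℤ) ≤ x₀ v ∧ x₀ v ≤ B) (t : ℕ) (v : V) :
    (idealRun G k B x₀ L (t + 1) v).down ↔ D v ≤ t ∧ (∀ u, G.Adj v u → D u ≤ t) ∧
      sat k (diffusion G k x₀ t v).1 = -1 ∧ sat k (diffusion G k x₀ (t + 1) v).1 = -1 ∧
      ∀ u, G.Adj v u → D u = D v + 1 → (idealRun G k B x₀ L t u).down := by
  have h1 := (exp_val_idealRun (L := L) hk hB h₀ (t + 1) v).2
  rw [idealRun_succ] at h1 ⊢
  simp only [cellStep] at h1 ⊢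
  simp only [Multiset.mem_map, Finset.mem_val, mem_nbrs, forall_exists_index, and_imp,
    forall_apply_eq_imp_iff₂, dist_ne_none_iff hD, h1, (exp_val_idealRun (L := L) hk hB h₀ t v).2]
  refine and_congr_right fun hv => and_congr_right fun hu => and_congr_right fun _ =>
    and_congr_right fun _ => forall₂_congr fun u hadj => ?_
  rw [dist_eq_map_succ_iff hD hadj hv, and_iff_left (hu u hadj)]

theorem alarm_idealRun_succ_of_leader {v : V} (hv : L v) (t : ℕ) :
    (idealRun G k B x₀ L (t + 1) v).alarm ↔
      (idealRun G k B x₀ L t v).alarm ∨ (idealRun G k B x₀ L t v).down := by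
  rw [idealRun_succ]
  simp [cellStep, leader_idealRun, hv]

theorem alarm_idealRun_succ_of_not_leader {D : V → ℕ} (hD : IsDistTo G L D)
    {v : V} (hv : ¬L v) (t : ℕ) :
    (idealRun G k B x₀ L (t + 1) v).alarm ↔ D v ≤ t ∧
      ∀ u, G.Adj v u → D v = D u + 1 → (idealRun G k B x₀ L t u).alarm := by
  rw [idealRun_succ]
  simp only [cellStep, leader_idealRun, hv, Multiset.mem_map, Finset.mem_val, mem_nbrs,
    forall_exists_index, and_imp, forall_apply_eq_imp_iff₂, dist_ne_none_iff hD, false_and,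
    false_or, not_false_eq_true, true_and]
  refine and_congr_right fun ht => forall₂_congr fun u hadj => imp_congr_left ?_
  by_cases hu : D u ≤ t
  · rw [dist_eq_map_succ_iff hD hadj.symm hu, and_iff_left ht]
  · rw [dist_idealRun hD, dist_idealRun hD, if_pos ht, if_neg hu]
    simp only [Option.map_none, reduceCtorEq, false_iff]
    omega

theorem refuted_idealRun_succ {D : V → ℕ} (hD : IsDistTo G L D) (t : ℕ) (v : V) :
    (idealRun G k B x₀ L (t + 1) v).refuted ↔
    (idealRun G k B x₀ L t v).refuted ∨ ∃ u, G.Adj v u ∧ D v ≤ t ∧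
      ((D u = D v ∧ (idealRun G k B x₀ L t v).alarm ∧ ¬(idealRun G k B x₀ L t u).alarm) ∨
        ((D u = D v + 1 ∧ D u ≤ t) ∧ (((idealRun G k B x₀ L t v).lastAlarm ∧
          ¬(idealRun G k B x₀ L t u).alarm) ∨ (idealRun G k B x₀ L t u).refuted))) := by
  rw [idealRun_succ]
  simp only [cellStep, Multiset.mem_map, Finset.mem_val, mem_nbrs, exists_exists_and_eq_and,
    dist_ne_none_iff hD]
  refine or_congr_right (exists_congr fun u => and_congr_right fun hadj =>
    and_congr_right fun hv => ?_)
  rw [dist_eq_iff hD hadj hv, dist_eq_map_succ_iff hD hadj hv]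

end Ideal

/-! ### Correctness of the synchronous algorithm -/

section Correctness

variable {V : Type*} [Fintype V] {G : SimpleGraph V} {k B : ℕ} {x₀ : V → ℤ} {L : V → Prop}
  {D : V → ℕ}

/-- If all leaders find their `down` flag set at the same time, the reports they rely on form a
slanted cut through the whole graph, so the sum is negative. -/
theorem sum_neg_of_leaders_down [Nonempty V] (hD : IsDistTo G L D)
    (hk : ∀ v, (nbrs G v).card ≤ k) (hB : 8 * k ≤ B) (h₀ : ∀ v, -(B : ℤ) ≤ x₀ v ∧ x₀ v ≤ B)
    {t : ℕ} (ht : ∀ r, L r → (idealRun G k B x₀ L t r).down) : ∑ v, x₀ v < 0 := by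
  have hpos : ∀ s v, (idealRun G k B x₀ L s v).down → s ≠ 0 := by
    rintro _ v h rfl
    exact h
  have key : ∀ d v, D v = d → d < t ∧ (idealRun G k B x₀ L (t - d) v).down := by
    intro d
    induction d with
    | zero =>
      intro v hv
      have := ht v ((hD.eq_zero_iff v).1 hv)
      exact ⟨Nat.pos_of_ne_zero (hpos _ _ this), this⟩
    | succ d ih =>
      intro v hv
      obtain ⟨u, hu, huv⟩ := hD.exists_pred v (by omega)
      obtain ⟨h1, h2⟩ := ih u (by omega)
      rw [show t - d = t - (d + 1) + 1 by omega, down_idealRun_succ hD hk hB h₀] at h2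
      have h3 := h2.2.2.2.2 v hu.symm huv
      exact ⟨by have := hpos _ _ h3; omega, h3⟩
  have hcut : ∀ v, sat k (diffusion G k x₀ (t - D v - 1) v).1 = -1 ∧
      sat k (diffusion G k x₀ (t - D v - 1 + 1) v).1 = -1 := by
    intro v
    obtain ⟨h1, h2⟩ := key _ v rfl
    rw [show t - D v = t - D v - 1 + 1 by omega, down_idealRun_succ hD hk hB h₀] at h2
    exact ⟨h2.2.2.1, h2.2.2.2.1⟩
  refine sum_neg_of_cut (fun v => t - D v - 1) (fun u v h => ?_) (fun v => (hcut v).1)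
    fun v => (hcut v).2
  have h1 := hD.le_succ u v h.symm
  have h2 := (key _ u rfl).1
  have h3 := (key _ v rfl).1
  omega

theorem eventually_down (hG : G.Connected) (hD : IsDistTo G L D)
    (hk : ∀ v, (nbrs G v).card ≤ k) (hB : 8 * k ≤ B) (h₀ : ∀ v, -(B : ℤ) ≤ x₀ v ∧ x₀ v ≤ B)
    (hS : ∑ v, x₀ v < 0) : ∃ T, ∀ t ≥ T, ∀ v, (idealRun G k B x₀ L t v).down := by
  obtain ⟨T, hT⟩ := eventually_sat_of_sum_neg hG hk hS
  set N := ∑ v, D v with hN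
  have hDN : ∀ v, D v ≤ N := fun v =>
    Finset.single_le_sum (f := D) (fun _ _ => Nat.zero_le _) (Finset.mem_univ v)
  have key : ∀ j v, N + 1 ≤ D v + j → ∀ t ≥ T + N + j, (idealRun G k B x₀ L t v).down := by
    intro j
    induction j with
    | zero =>
      intro v hv
      have := hDN v
      omega
    | succ j ih =>
      intro v hv t ht
      obtain ⟨t, rfl⟩ : ∃ t', t = t' + 1 := ⟨t - 1, by omega⟩
      rw [down_idealRun_succ hD hk hB h₀]
      refine ⟨by have := hDN v; omega, fun u _ => by have := hDN u; omega, hT t (by omega) v,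
        hT (t + 1) (by omega) v, fun u _ hu => ih u (by omega) t (by omega)⟩
  exact ⟨T + N + (N + 1), fun t ht v => key (N + 1) v (by omega) t ht⟩

theorem alarm_succ (hD : IsDistTo G L D) {t : ℕ} {v : V}
    (h : (idealRun G k B x₀ L t v).alarm) : (idealRun G k B x₀ L (t + 1) v).alarm := by
  induction t generalizing v with
  | zero => exact h.elim
  | succ t ih =>
    by_cases hv : L v
    · exact (alarm_idealRun_succ_of_leader hv _).2 (.inl h)
    · rw [alarm_idealRun_succ_of_not_leader hD hv] at h ⊢
      exact ⟨h.1.trans (Nat.le_succ t), fun u hu huv => ih (h.2 u hu huv)⟩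

theorem alarm_mono (hD : IsDistTo G L D) {s t : ℕ} (hst : s ≤ t) {v : V}
    (h : (idealRun G k B x₀ L s v).alarm) : (idealRun G k B x₀ L t v).alarm := by
  induction t, hst using Nat.le_induction with
  | base => exact h
  | succ t _ ih => exact alarm_succ hD ih

/-- A node inherits the alarm from the nodes above it. -/
theorem alarm_of_alarm_succ (hD : IsDistTo G L D) {t : ℕ} {u v : V} (h : G.Adj v u)
    (huv : D u = D v + 1) (hu : (idealRun G k B x₀ L (t + 1) u).alarm) :
    (idealRun G k B x₀ L t v).alarm := by
  rw [alarm_idealRun_succ_of_not_leader hD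
    (fun hL => by have := (hD.eq_zero_iff u).2 hL; omega)] at hu
  exact hu.2 v h.symm huv

/-- An alarm of all leaders travels downwards at unit speed. -/
theorem alarm_of_leaders (hD : IsDistTo G L D) (hL : ∃ r, L r) {s : ℕ}
    (h : ∀ r, L r → (idealRun G k B x₀ L s r).alarm) (v : V) :
    (idealRun G k B x₀ L (s + D v) v).alarm := by
  have hs : s ≠ 0 := by
    rintro rfl
    exact hL.elim fun r hr => h r hr
  induction hd : D v generalizing v with
  | zero => exact h v ((hD.eq_zero_iff v).1 hd)
  | succ d ih =>
    rw [← add_assoc, alarm_idealRun_succ_of_not_leader hD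
      (fun hL => by have := (hD.eq_zero_iff v).2 hL; omega)]
    exact ⟨by omega, fun u _ hu => ih u (by omega)⟩

/-- A refuted node has received the alarm from leaders that raised it before some other leader. -/
theorem exists_early_alarm_of_refuted (hD : IsDistTo G L D) (hL : ∃ r, L r) {t : ℕ} {v : V}
    (h : (idealRun G k B x₀ L t v).refuted) : ∃ s, (idealRun G k B x₀ L (s + D v) v).alarm ∧
      ¬∀ r, L r → (idealRun G k B x₀ L s r).alarm := by
  induction t generalizing v with
  | zero => exact h.elim
  | succ t ih =>
    rw [refuted_idealRun_succ hD] at h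
    rcases h with h | ⟨u, hu, hv, ⟨huv, h1, h2⟩ | ⟨⟨huv, hut⟩, ⟨h1, h2⟩ | h1⟩⟩
    · exact ih h
    · refine ⟨t - D v, by rwa [Nat.sub_add_cancel hv], fun hall => h2 ?_⟩
      have := alarm_of_leaders hD hL hall u
      rwa [huv, Nat.sub_add_cancel hv] at this
    · cases t with
      | zero => exact h1.elim
      | succ t =>
        have h1 : (idealRun G k B x₀ L t v).alarm := h1
        refine ⟨t - D v, by rwa [Nat.sub_add_cancel (by omega)], fun hall => h2 ?_⟩
        have := alarm_of_leaders hD hL hall u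
        rwa [show t - D v + D u = t + 1 by omega] at this
    · obtain ⟨s, hs, hs'⟩ := ih h1
      rw [huv, ← add_assoc] at hs
      exact ⟨s, alarm_of_alarm_succ hD hu huv hs, hs'⟩

/-- A leader that raises the alarm last is never refuted. -/
theorem exists_leader_not_refuted (hD : IsDistTo G L D) (hL : ∃ r, L r) :
    ∃ r, L r ∧ ∀ t, ¬(idealRun G k B x₀ L t r).refuted := by
  by_contra! hcon
  have hex : ∀ r : {r // L r}, ∃ s, (idealRun G k B x₀ L s r.1).alarm ∧
      ¬∀ r, L r → (idealRun G k B x₀ L s r).alarm := by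
    rintro ⟨r, hr⟩
    obtain ⟨t, ht⟩ := hcon r hr
    have := exists_early_alarm_of_refuted hD hL ht
    rwa [(hD.eq_zero_iff r).2 hr] at this
  choose f hf hf' using hex
  have : Nonempty {r // L r} := nonempty_subtype.2 hL
  obtain ⟨m, hm⟩ := Finite.exists_max f
  exact hf' m fun r hr => alarm_mono hD (hm ⟨r, hr⟩) (hf ⟨r, hr⟩)

theorem refuted_mono {s t : ℕ} (hst : s ≤ t) {v : V}
    (h : (idealRun G k B x₀ L s v).refuted) : (idealRun G k B x₀ L t v).refuted := by
  induction t, hst using Nat.le_induction with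
  | base => exact h
  | succ t _ ih =>
    rw [idealRun_succ]
    exact .inl ih

/-- Refutations travel upwards to the leaders. -/
theorem not_refuted (hr : ∀ r, L r → ∀ t, ¬(idealRun G k B x₀ L t r).refuted)
    (hD : IsDistTo G L D) (t : ℕ) (v : V) : ¬(idealRun G k B x₀ L t v).refuted := by
  induction hd : D v generalizing v t with
  | zero => exact hr v ((hD.eq_zero_iff v).1 hd) t
  | succ d ih =>
    intro hv
    obtain ⟨u, hu, huv⟩ := hD.exists_pred v (by omega)
    refine ih (t + D v + 1) u (by omega) ((refuted_idealRun_succ hD _ _).2 (.inr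
      ⟨v, hu.symm, by omega, .inr ⟨⟨huv, by omega⟩, .inr (refuted_mono (by omega) hv)⟩⟩))

/-- Without refutations all leaders raise the alarm simultaneously. -/
theorem alarm_iff_alarm (hG : G.Connected)
    (hr : ∀ r, L r → ∀ t, ¬(idealRun G k B x₀ L t r).refuted)
    (hD : IsDistTo G L D) (s : ℕ) (u v : V) :
    (idealRun G k B x₀ L (s + D v) v).alarm ↔ (idealRun G k B x₀ L (s + D u) u).alarm := by
  have hnot := not_refuted hr hD
  have hadj : ∀ u v, G.Adj v u → (idealRun G k B x₀ L (s + D v) v).alarm →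
      (idealRun G k B x₀ L (s + D u) u).alarm := by
    intro u v h hv
    have h1 := hD.le_succ v u h
    have h2 := hD.le_succ u v h.symm
    rcases lt_trichotomy (D u) (D v) with hlt | heq | hgt
    · rw [show D v = D u + 1 by omega, ← add_assoc] at hv
      exact alarm_of_alarm_succ hD h.symm (by omega) hv
    · by_contra hu
      refine hnot (s + D v + 1) v ((refuted_idealRun_succ hD _ _).2 (.inr
        ⟨u, h, by omega, .inl ⟨heq, hv, ?_⟩⟩))
      rwa [← heq]
    · by_contra hu
      refine hnot (s + D v + 1 + 1) v ((refuted_idealRun_succ hD _ _).2 (.inr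
        ⟨u, h, by omega, .inr ⟨⟨by omega, by omega⟩, .inl ⟨hv, ?_⟩⟩⟩))
      rwa [add_assoc, ← show D u = D v + 1 by omega]
  have hwalk : ∀ u v, (idealRun G k B x₀ L (s + D v) v).alarm →
      (idealRun G k B x₀ L (s + D u) u).alarm := by
    intro u v hv
    induction (SimpleGraph.reachable_iff_reflTransGen v u).1 (hG.preconnected v u) with
    | refl => exact hv
    | tail _ h ih => exact hadj _ _ h ih
  exact ⟨hwalk u v, hwalk v u⟩

/-- Without refutations the alarm is raised precisely if the sum is negative. -/
theorem eventually_alarm_iff (hG : G.Connected) (hL : ∃ r, L r)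
    (hr : ∀ r, L r → ∀ t, ¬(idealRun G k B x₀ L t r).refuted)
    (hD : IsDistTo G L D) (hk : ∀ v, (nbrs G v).card ≤ k) (hB : 8 * k ≤ B)
    (h₀ : ∀ v, -(B : ℤ) ≤ x₀ v ∧ x₀ v ≤ B) :
    ∃ T, ∀ t ≥ T, ∀ v, ((idealRun G k B x₀ L t v).alarm ↔ ∑ v, x₀ v < 0) := by
  have := hG.nonempty
  by_cases hS : ∑ v, x₀ v < 0
  · obtain ⟨T, hT⟩ := eventually_down hG hD hk hB h₀ hS
    have hall : ∀ r, L r → (idealRun G k B x₀ L (T + 1) r).alarm := fun r hr =>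
      (alarm_idealRun_succ_of_leader hr T).2 (.inr (hT T le_rfl r))
    refine ⟨T + 1 + ∑ v, D v, fun t ht v => iff_of_true
      (alarm_mono hD ?_ (alarm_of_leaders hD hL hall v)) hS⟩
    have := Finset.single_le_sum (f := D) (fun _ _ => Nat.zero_le _) (Finset.mem_univ v)
    omega
  · have hnone : ∀ s, ∀ r, L r → ¬(idealRun G k B x₀ L s r).alarm := by
      intro s
      induction s with
      | zero => exact fun _ _ h => h
      | succ s ih =>
        intro r hLr h
        refine hS (sum_neg_of_leaders_down hD hk hB h₀ (t := s) fun r' hr' => ?_)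
        have h1 := alarm_iff_alarm hG hr hD (s + 1) r' r
        rw [(hD.eq_zero_iff r).2 hLr, (hD.eq_zero_iff r').2 hr', add_zero] at h1
        exact ((alarm_idealRun_succ_of_leader hr' s).1 (h1.1 h)).resolve_left (ih r' hr')
    obtain ⟨r, hLr⟩ := hL
    refine ⟨0, fun t _ v => iff_of_false (fun h => ?_) hS⟩
    have h1 := (alarm_iff_alarm hG hr hD t r v).1 (alarm_mono hD (by omega) h)
    exact hnone _ r hLr h1

end Correctness

/-! ### Simulating synchronous runs, with restarts -/

/-- A synchronous algorithm for networks with labelled nodes, some of which are leaders, in which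
nodes may abdicate. -/
structure SyncAlgorithm (Λ Q : Type) where
  /-- the initial state of a node, given its label and whether it is a leader -/
  init : Λ → Prop → Q
  /-- the transition function -/
  step : Q → Multiset Q → Q
  /-- the states in which a node wants to abdicate -/
  Abdicates : Q → Prop

/-- The state of a node simulating a synchronous algorithm with states `Q`: epochs number the
restarts and phases number the steps of the synchronous run in an epoch. -/
structure Station (Λ Q : Type) where
  /-- the epoch, modulo three -/
  epoch : ZMod 3
  /-- the phase, modulo three -/
  phase : ZMod 3
  /-- whether the node is a leader in this epoch -/
  leader : Prop
  /-- the label -/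
  label : Λ
  /-- the simulated state in this phase -/
  cur : Q
  /-- the simulated state in the phase before -/
  last : Q

/-- A station is determined by its six components. -/
def stationEquiv (Λ Q : Type) : Station Λ Q ≃ (ZMod 3 × ZMod 3) × (Prop × Λ) × (Q × Q) where
  toFun q := ((q.epoch, q.phase), (q.leader, q.label), (q.cur, q.last))
  invFun p := ⟨p.1.1, p.1.2, p.2.1.1, p.2.1.2, p.2.2.1, p.2.2.2⟩
  left_inv _ := rfl
  right_inv _ := rfl

instance (Λ Q : Type) [Finite Λ] [Finite Q] : Finite (Station Λ Q) :=
  Finite.of_equiv _ (stationEquiv Λ Q).symm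

section Simulation

variable {Λ Q : Type} (A : SyncAlgorithm Λ Q)

/-- The state at the beginning of an epoch. -/
def SyncAlgorithm.start (epoch : ZMod 3) (leader : Prop) (label : Λ) : Station Λ Q :=
  ⟨epoch, 0, leader, label, A.init label leader, A.init label leader⟩

/-- A node takes part in the next phase of the synchronous run. Neighbours may be one phase
ahead; their previous simulated state is then the relevant one. -/
noncomputable def SyncAlgorithm.advance (q : Station Λ Q) (m : Multiset (Station Λ Q)) :
    Station Λ Q :=
  { q with
    phase := q.phase + 1
    cur := A.step q.cur
      (m.map fun r => open Classical in if r.phase = q.phase then r.cur else r.last)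
    last := q.cur }

open Classical in
/-- The transition function of the simulation. A node waits for neighbours that are behind,
follows neighbours into a new epoch, opens a new epoch without being a leader any more when it
abdicates, and enters the next phase otherwise. -/
noncomputable def SyncAlgorithm.simulate (q : Station Λ Q) (m : Multiset (Station Λ Q)) :
    Station Λ Q :=
  if ∃ r ∈ m, r.epoch + 1 = q.epoch ∨ (r.epoch = q.epoch ∧ r.phase + 1 = q.phase) then q
  else if ∃ r ∈ m, r.epoch = q.epoch + 1 then A.start (q.epoch + 1) q.leader q.label
  else if A.Abdicates q.cur then A.start (q.epoch + 1) False q.label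
  else A.advance q m

variable {V : Type*} [Fintype V] (G : SimpleGraph V)

/-- `W` is a run of the simulation in which the node `σ t` moves at time `t`. -/
structure SyncAlgorithm.IsExecution (lab : V → Λ) (σ : ℕ → V) (W : ℕ → V → Station Λ Q) :
    Prop where
  zero : ∀ v, W 0 v = A.start 0 True (lab v)
  selected : ∀ t, W (t + 1) (σ t) = A.simulate (W t (σ t)) ((nbrs G (σ t)).val.map (W t))
  idle : ∀ t v, v ≠ σ t → W (t + 1) v = W t v
  fair : ∀ v n, ∃ t ≥ n, σ t = v

open Classical in
/-- The epoch and the phase of each node, as natural numbers. -/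
noncomputable def clock (W : ℕ → V → Station Λ Q) : ℕ → V → ℕ × ℕ
  | 0 => fun _ => (0, 0)
  | t + 1 => fun v =>
    if (W (t + 1) v).epoch = (W t v).epoch then
      if (W (t + 1) v).phase = (W t v).phase then clock W t v
      else ((clock W t v).1, (clock W t v).2 + 1)
    else ((clock W t v).1 + 1, 0)

/-- The clocks `c` and `d` may belong to adjacent nodes: they show the same epoch and consecutive
phases, or consecutive epochs, the later of which has only just begun. -/
def Near (c d : ℕ × ℕ) : Prop :=
  (c.1 = d.1 ∧ c.2 ≤ d.2 + 1 ∧ d.2 ≤ c.2 + 1) ∨ (c.1 = d.1 + 1 ∧ c.2 = 0) ∨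
    (d.1 = c.1 + 1 ∧ d.2 = 0)

theorem Near.symm {c d : ℕ × ℕ} (h : Near c d) : Near d c := by
  unfold Near at *
  omega

/-- The clock `c` is behind the clock `d`. -/
def Behind (c d : ℕ × ℕ) : Prop := c.1 < d.1 ∨ (c.1 = d.1 ∧ c.2 < d.2)

/-- The moves of a node `v` when the clocks show `C` and the states are `W`, with the clock and
the state that result. -/
inductive Move (C : V → ℕ × ℕ) (W : V → Station Λ Q) (v : V) : ℕ × ℕ → Station Λ Q → Prop
  | follow (u : V) (hu : G.Adj v u) (hC : (C u).1 = (C v).1 + 1) :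
      Move C W v ((C v).1 + 1, 0) (A.start ((W v).epoch + 1) (W v).leader (W v).label)
  | abdicate (hC : ∀ u, G.Adj v u → (C u).1 = (C v).1) (h : A.Abdicates (W v).cur) :
      Move C W v ((C v).1 + 1, 0) (A.start ((W v).epoch + 1) False (W v).label)
  | advance (hC : ∀ u, G.Adj v u → (C u).1 = (C v).1) (h : ¬A.Abdicates (W v).cur) :
      Move C W v ((C v).1, (C v).2 + 1) (A.advance (W v) ((nbrs G v).val.map W))

variable {A G} {lab : V → Λ} {σ : ℕ → V} {W : ℕ → V → Station Λ Q}

theorem clock_succ_of_eq {V : Type*} {W : ℕ → V → Station Λ Q} {t : ℕ} {v : V}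
    (h : W (t + 1) v = W t v) :
    clock W (t + 1) v = clock W t v := by
  simp [clock, h]

/-- The clocks shown modulo three, together with the proximity of adjacent clocks, determine what
a selected node does. -/
theorem move_or_behind (hW : A.IsExecution G lab σ W) {t : ℕ}
    (hmod : ∀ v, (W t v).epoch = ((clock W t v).1 : ZMod 3) ∧
      (W t v).phase = ((clock W t v).2 : ZMod 3))
    (hnear : ∀ v u, G.Adj v u → Near (clock W t v) (clock W t u)) :
    (W (t + 1) (σ t) = W t (σ t) ∧ ∃ u, G.Adj (σ t) u ∧ Behind (clock W t u) (clock W t (σ t))) ∨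
    ((∀ u, G.Adj (σ t) u → ¬Behind (clock W t u) (clock W t (σ t))) ∧
      Move A G (clock W t) (W t) (σ t) (clock W (t + 1) (σ t)) (W (t + 1) (σ t))) := by
  have hsel := hW.selected t
  generalize σ t = v at hsel ⊢
  have hbehind : (∃ r ∈ (nbrs G v).val.map (W t), r.epoch + 1 = (W t v).epoch ∨
      (r.epoch = (W t v).epoch ∧ r.phase + 1 = (W t v).phase)) ↔
      ∃ u, G.Adj v u ∧ Behind (clock W t u) (clock W t v) := by
    simp only [Multiset.mem_map, Finset.mem_val, mem_nbrs, exists_exists_and_eq_and]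
    refine exists_congr fun u => and_congr_right fun hu => ?_
    have hn := hnear v u hu
    unfold Near at hn
    rw [(hmod u).1, (hmod v).1, (hmod u).2, (hmod v).2, Behind,
      natCast_zmod_three_succ_inj (by omega) (by omega),
      natCast_zmod_three_inj (by omega) (by omega)]
    rcases hn with hn | hn | hn
    · rw [natCast_zmod_three_succ_inj (by omega) (by omega)]
      omega
    · omega
    · omega
  have hahead : (∃ r ∈ (nbrs G v).val.map (W t), r.epoch = (W t v).epoch + 1) ↔
      ∃ u, G.Adj v u ∧ (clock W t u).1 = (clock W t v).1 + 1 := by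
    simp only [Multiset.mem_map, Finset.mem_val, mem_nbrs, exists_exists_and_eq_and]
    refine exists_congr fun u => and_congr_right fun hu => ?_
    have hn := hnear v u hu
    unfold Near at hn
    rw [(hmod u).1, (hmod v).1, eq_comm, natCast_zmod_three_succ_inj (by omega) (by omega)]
    omega
  have hne : ∀ a : ZMod 3, a + 1 ≠ a := by decide
  have hstart : ∀ l, W (t + 1) v = A.start ((W t v).epoch + 1) l (W t v).label →
      clock W (t + 1) v = ((clock W t v).1 + 1, 0) := by
    intro l hl
    simp [clock, hl, SyncAlgorithm.start, hne]
  rw [SyncAlgorithm.simulate] at hsel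
  by_cases h1 : ∃ u, G.Adj v u ∧ Behind (clock W t u) (clock W t v)
  · rw [if_pos (hbehind.2 h1)] at hsel
    exact .inl ⟨hsel, h1⟩
  · rw [if_neg (hbehind.not.2 h1)] at hsel
    push Not at h1
    refine .inr ⟨h1, ?_⟩
    by_cases h2 : ∃ u, G.Adj v u ∧ (clock W t u).1 = (clock W t v).1 + 1
    · rw [if_pos (hahead.2 h2)] at hsel
      obtain ⟨u, hu, huv⟩ := h2
      rw [hstart _ hsel, hsel]
      exact .follow u hu huv
    · rw [if_neg (hahead.not.2 h2)] at hsel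
      push Not at h2
      have hsame : ∀ u, G.Adj v u → (clock W t u).1 = (clock W t v).1 := by
        intro u hu
        have hn := hnear v u hu
        have hb := h1 u hu
        have ha := h2 u hu
        unfold Near at hn
        unfold Behind at hb
        omega
      by_cases h3 : A.Abdicates (W t v).cur
      · rw [if_pos h3] at hsel
        rw [hstart _ hsel, hsel]
        exact .abdicate hsame h3
      · rw [if_neg h3] at hsel
        have hclock : clock W (t + 1) v = ((clock W t v).1, (clock W t v).2 + 1) := by
          simp [clock, hsel, SyncAlgorithm.advance, hne]
        rw [hclock, hsel]
        exact .advance hsame h3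

theorem clock_spec (hW : A.IsExecution G lab σ W) (t : ℕ) :
    (∀ v, (W t v).epoch = ((clock W t v).1 : ZMod 3) ∧
      (W t v).phase = ((clock W t v).2 : ZMod 3)) ∧
    ∀ v u, G.Adj v u → Near (clock W t v) (clock W t u) := by
  induction t with
  | zero =>
    exact ⟨fun v => by simp [hW.zero, SyncAlgorithm.start, clock],
      fun v u _ => .inl (by simp [clock])⟩
  | succ t ih =>
    have hidle : ∀ v, v ≠ σ t → clock W (t + 1) v = clock W t v := fun v hv =>
      clock_succ_of_eq (hW.idle t v hv)
    rcases move_or_behind hW ih.1 ih.2 with ⟨h, -⟩ | ⟨hb, hm⟩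
    · have hall : W (t + 1) = W t := by
        funext v
        by_cases hv : v = σ t
        · rw [hv, h]
        · exact hW.idle t v hv
      have hc : clock W (t + 1) = clock W t := funext fun v => clock_succ_of_eq (congrFun hall v)
      rwa [hall, hc]
    · constructor
      · intro v
        by_cases hv : v = σ t
        · subst hv
          have := ih.1 (σ t)
          generalize clock W (t + 1) (σ t) = c, W (t + 1) (σ t) = w at hm
          cases hm <;> simp [SyncAlgorithm.start, SyncAlgorithm.advance, this]
        · rw [hidle v hv, hW.idle t v hv]
          exact ih.1 v
      · have hkey : ∀ u, G.Adj (σ t) u → Near (clock W (t + 1) (σ t)) (clock W (t + 1) u) := by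
          intro u hu
          rw [hidle u hu.ne']
          have hn := ih.2 _ u hu
          have hbu := hb u hu
          generalize clock W (t + 1) (σ t) = c, W (t + 1) (σ t) = w at hm
          unfold Near at hn ⊢
          unfold Behind at hbu
          cases hm with
          | follow => dsimp only; omega
          | abdicate hC => have := hC u hu; dsimp only; omega
          | advance hC => have := hC u hu; dsimp only; omega
        intro v u hvu
        by_cases hv : v = σ t
        · subst hv
          exact hkey u hvu
        · by_cases hu : u = σ t
          · subst hu
            exact (hkey v hvu.symm).symm
          · rw [hidle v hv, hidle u hu]
            exact ih.2 v u hvu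

theorem near_clock (hW : A.IsExecution G lab σ W) (t : ℕ) {v u : V} (h : G.Adj v u) :
    Near (clock W t v) (clock W t u) := (clock_spec hW t).2 v u h

/-- At each time, each node stays as it is or makes a move, and a selected node stays only if a
neighbour is behind. -/
theorem stay_or_move (hW : A.IsExecution G lab σ W) (t : ℕ) (v : V) :
    (W (t + 1) v = W t v ∧ clock W (t + 1) v = clock W t v ∧
      (σ t = v → ∃ u, Behind (clock W t u) (clock W t v))) ∨
    ((∀ u, G.Adj v u → ¬Behind (clock W t u) (clock W t v)) ∧
      Move A G (clock W t) (W t) v (clock W (t + 1) v) (W (t + 1) v)) := by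
  by_cases hv : v = σ t
  · subst hv
    rcases move_or_behind hW (clock_spec hW t).1 (clock_spec hW t).2 with ⟨h, u, -, hu⟩ | h
    · exact .inl ⟨h, clock_succ_of_eq h, fun _ => ⟨u, hu⟩⟩
    · exact .inr h
  · have h := hW.idle t v hv
    exact .inl ⟨h, clock_succ_of_eq h, fun h => absurd h.symm hv⟩

theorem monotone_epoch (hW : A.IsExecution G lab σ W) (v : V) :
    Monotone fun t => (clock W t v).1 := by
  refine monotone_nat_of_le_succ fun t => ?_
  rcases stay_or_move hW t v with ⟨-, h, -⟩ | ⟨-, hm⟩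
  · rw [h]
  · generalize clock W (t + 1) v = c, W (t + 1) v = w at hm
    cases hm <;> simp

theorem label_eq (hW : A.IsExecution G lab σ W) (t : ℕ) (v : V) : (W t v).label = lab v := by
  induction t with
  | zero => rw [hW.zero]; rfl
  | succ t ih =>
    rcases stay_or_move hW t v with ⟨h, -, -⟩ | ⟨-, hm⟩
    · rwa [h]
    · generalize clock W (t + 1) v = c, W (t + 1) v = w at hm
      cases hm <;> exact ih

theorem leader_of_leader_succ (hW : A.IsExecution G lab σ W) {t : ℕ} {v : V}
    (h : (W (t + 1) v).leader) : (W t v).leader := by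
  rcases stay_or_move hW t v with ⟨h', -, -⟩ | ⟨-, hm⟩
  · rwa [h'] at h
  · generalize clock W (t + 1) v = c, W (t + 1) v = w at hm h
    cases hm with
    | follow => exact h
    | abdicate => exact h.elim
    | advance => exact h

theorem leader_antitone (hW : A.IsExecution G lab σ W) {s t : ℕ} (hst : s ≤ t) {v : V}
    (h : (W t v).leader) : (W s v).leader := by
  induction t, hst using Nat.le_induction with
  | base => exact h
  | succ t _ ih => exact ih (leader_of_leader_succ hW h)

theorem leader_of_epoch_eq (hW : A.IsExecution G lab σ W) {s t : ℕ} (hst : s ≤ t) {v : V}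
    (hE : (clock W t v).1 = (clock W s v).1) (h : (W s v).leader) : (W t v).leader := by
  induction t, hst using Nat.le_induction with
  | base => exact h
  | succ t hst ih =>
    have h1 : (clock W s v).1 ≤ (clock W t v).1 := monotone_epoch hW v hst
    have h2 : (clock W t v).1 ≤ (clock W (t + 1) v).1 := monotone_epoch hW v (Nat.le_succ t)
    have h3 := ih (by omega)
    rcases stay_or_move hW t v with ⟨h', -, -⟩ | ⟨-, hm⟩
    · rwa [h']
    · generalize clock W (t + 1) v = c, W (t + 1) v = w at hm h2 hE
      cases hm with
      | follow => exact h3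
      | abdicate => dsimp only at hE; omega
      | advance => exact h3

/-- The leaders of the epoch `e`. The nodes that never reach this epoch are counted as if they
entered it unchanged. -/
def LeaderOf (W : ℕ → V → Station Λ Q) (e : ℕ) (v : V) : Prop :=
  ∀ t, (clock W t v).1 ≤ e → (W t v).leader

theorem leaderOf_iff (hW : A.IsExecution G lab σ W) (t : ℕ) (v : V) :
    LeaderOf W (clock W t v).1 v ↔ (W t v).leader := by
  refine ⟨fun h => h t le_rfl, fun h s hs => ?_⟩
  rcases le_total s t with hst | hst
  · exact leader_antitone hW hst h
  · exact leader_of_epoch_eq hW hst (le_antisymm hs (monotone_epoch hW v hst)) h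

/-- The synchronous run that is simulated in the epoch `e`. -/
noncomputable def SyncAlgorithm.epochRun (A : SyncAlgorithm Λ Q) (G : SimpleGraph V) (lab : V → Λ)
    (W : ℕ → V → Station Λ Q) (e : ℕ) : ℕ → V → Q :=
  syncRun G A.step fun v => A.init (lab v) (LeaderOf W e v)

/-- Each node plays a prefix of the synchronous run of its epoch. -/
theorem cur_last_eq (hW : A.IsExecution G lab σ W) (t : ℕ) (v : V) :
    (W t v).cur = A.epochRun G lab W (clock W t v).1 (clock W t v).2 v ∧
      ∀ p, (clock W t v).2 = p + 1 → (W t v).last = A.epochRun G lab W (clock W t v).1 p v := by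
  have hstart : ∀ (t : ℕ) (v : V) (a : ZMod 3) (l : Prop), (clock W t v).2 = 0 →
      W t v = A.start a l (lab v) →
      (W t v).cur = A.epochRun G lab W (clock W t v).1 (clock W t v).2 v ∧
      ∀ p, (clock W t v).2 = p + 1 → (W t v).last = A.epochRun G lab W (clock W t v).1 p v := by
    intro t v a l hc hl
    refine ⟨?_, fun p hp => by omega⟩
    rw [hc, SyncAlgorithm.epochRun, syncRun, propext (leaderOf_iff hW t v), hl]
    rfl
  induction t generalizing v with
  | zero => exact hstart 0 v _ _ rfl (hW.zero v)
  | succ t ih =>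
    rcases stay_or_move hW t v with ⟨h, hc, -⟩ | ⟨hb, hm⟩
    · rw [h, hc]
      exact ih v
    · have hlab := label_eq hW t v
      generalize hc : clock W (t + 1) v = c, hw : W (t + 1) v = w at hm
      cases hm with
      | follow u hu hC =>
        rw [← hc, ← hw]
        exact hstart (t + 1) v _ _ (by rw [hc]) (by rw [hw, hlab])
      | abdicate hC h =>
        rw [← hc, ← hw]
        exact hstart (t + 1) v _ _ (by rw [hc]) (by rw [hw, hlab])
      | advance hC h =>
        dsimp only
        refine ⟨?_, fun p hp => ?_⟩
        · rw [SyncAlgorithm.epochRun, syncRun, SyncAlgorithm.advance]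
          dsimp only
          rw [(ih v).1, Multiset.map_map]
          refine congrArg _ (Multiset.map_congr rfl fun u hu => ?_)
          have hadj : G.Adj v u := mem_nbrs.1 hu
          have hn := near_clock hW t hadj
          have hE := hC u hadj
          have hbu := hb u hadj
          unfold Near at hn
          unfold Behind at hbu
          dsimp only [Function.comp_apply]
          have hphase : (W t u).phase = (W t v).phase ↔ (clock W t u).2 = (clock W t v).2 := by
            rw [((clock_spec hW t).1 u).2, ((clock_spec hW t).1 v).2,
              natCast_zmod_three_inj (by omega) (by omega)]
          by_cases hP : (clock W t u).2 = (clock W t v).2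
          · rw [if_pos (hphase.2 hP), (ih u).1, hP, hE]
            rfl
          · rw [if_neg (hphase.not.2 hP), (ih u).2 (clock W t v).2 (by omega), hE]
            rfl
        · rw [← Nat.succ_injective hp]
          exact (ih v).1

/-- What the simulation needs to know about a synchronous algorithm: some leader never abdicates,
and if none abdicates, then eventually all states satisfy `Good`. -/
structure SyncAlgorithm.Achieves (A : SyncAlgorithm Λ Q) (G : SimpleGraph V) (lab : V → Λ)
    (Good : Q → Prop) : Prop where
  leader_of_abdicates : ∀ (L : V → Prop) t v,
    A.Abdicates (syncRun G A.step (fun v => A.init (lab v) (L v)) t v) → L v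
  abdicates_mono : ∀ (L : V → Prop) s t v, s ≤ t →
    A.Abdicates (syncRun G A.step (fun v => A.init (lab v) (L v)) s v) →
    A.Abdicates (syncRun G A.step (fun v => A.init (lab v) (L v)) t v)
  exists_leader : ∀ L : V → Prop, (∃ r, L r) → ∃ r, L r ∧
    ∀ t, ¬A.Abdicates (syncRun G A.step (fun v => A.init (lab v) (L v)) t r)
  eventually_good : ∀ L : V → Prop, (∃ r, L r) →
    (∀ t v, ¬A.Abdicates (syncRun G A.step (fun v => A.init (lab v) (L v)) t v)) →
    ∃ T, ∀ t ≥ T, ∀ v, Good (syncRun G A.step (fun v => A.init (lab v) (L v)) t v)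

variable {Good : Q → Prop}

theorem exists_leaderOf [Nonempty V] (hW : A.IsExecution G lab σ W) (hA : A.Achieves G lab Good)
    (e : ℕ) : ∃ r, LeaderOf W e r := by
  induction e with
  | zero =>
    refine ⟨Classical.arbitrary V, fun t ht => ?_⟩
    refine leader_of_epoch_eq hW (Nat.zero_le t) (Nat.le_zero.1 ht) ?_
    rw [hW.zero]
    exact trivial
  | succ e ih =>
    obtain ⟨r, hr, hrun⟩ := hA.exists_leader _ ih
    refine ⟨r, fun t => ?_⟩
    induction t with
    | zero => exact fun _ => hr 0 (Nat.zero_le e)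
    | succ t iht =>
      intro ht
      have hmono : (clock W t r).1 ≤ (clock W (t + 1) r).1 := monotone_epoch hW r (Nat.le_succ t)
      have h1 := iht (hmono.trans ht)
      rcases stay_or_move hW t r with ⟨h, -, -⟩ | ⟨-, hm⟩
      · rwa [h]
      · have hlow := hr (t + 1)
        generalize clock W (t + 1) r = c, W (t + 1) r = w at hm ht hlow
        cases hm with
        | follow => exact h1
        | advance => exact h1
        | abdicate hC h =>
          dsimp only at ht
          rcases Nat.lt_or_ge (clock W t r).1 e with hlt | hge
          · exact hlow hlt
          · rw [(cur_last_eq hW t r).1, show (clock W t r).1 = e by omega] at h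
            exact absurd h (hrun _)

/-- Each new epoch costs a leader. -/
theorem ncard_leaderOf_add_epoch_le (hW : A.IsExecution G lab σ W) (hA : A.Achieves G lab Good)
    (t : ℕ) (v : V) :
    {u | LeaderOf W (clock W t v).1 u}.ncard + (clock W t v).1 ≤ Nat.card V := by
  induction t generalizing v with
  | zero => exact Set.ncard_le_card _
  | succ t ih =>
    rcases stay_or_move hW t v with ⟨-, h, -⟩ | ⟨-, hm⟩
    · rw [h]
      exact ih v
    · generalize hc : clock W (t + 1) v = c, hw : W (t + 1) v = w at hm
      cases hm with
      | follow u hu hC =>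
        have := ih u
        rwa [hC] at this
      | advance hC h => exact ih v
      | abdicate hC h =>
        dsimp only
        have hlt : {u | LeaderOf W ((clock W t v).1 + 1) u}.ncard <
            {u | LeaderOf W (clock W t v).1 u}.ncard := by
          refine Set.ncard_lt_ncard ⟨fun u hu s hs => hu s (by omega), fun hsub => ?_⟩
            (Set.toFinite _)
          rw [(cur_last_eq hW t v).1] at h
          have h1 : LeaderOf W ((clock W t v).1 + 1) v := hsub (hA.leader_of_abdicates _ _ _ h)
          have h2 := h1 (t + 1) (by rw [hc])
          rw [hw] at h2
          exact h2
        have := ih v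
        omega

theorem phase_mono (hW : A.IsExecution G lab σ W) {T : ℕ}
    (hT : ∀ t ≥ T, ∀ v, (clock W t v).1 = (clock W T v).1) (v : V) :
    Monotone fun t => (clock W (T + t) v).2 := by
  refine monotone_nat_of_le_succ fun t => ?_
  have h1 := hT (T + t) (by omega) v
  have h2 := hT (T + t + 1) (by omega) v
  rw [← add_assoc]
  rcases stay_or_move hW (T + t) v with ⟨-, h, -⟩ | ⟨-, hm⟩
  · rw [h]
  · generalize clock W (T + t + 1) v = c, W (T + t + 1) v = w at hm h2
    cases hm <;> dsimp only at h2 ⊢ <;> omega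

/-- In the last epoch the phases grow, since a node whose clock shows the least time moves when it
is selected. -/
theorem exists_phase_unbounded [Nonempty V] (hW : A.IsExecution G lab σ W) {T : ℕ}
    (hT : ∀ t ≥ T, ∀ v, (clock W t v).1 = (clock W T v).1) :
    ∃ v, ∀ M, ∃ t, M < (clock W (T + t) v).2 := by
  by_contra! hcon
  obtain ⟨T', hT'⟩ := exists_forall_eq_of_monotone (phase_mono hW hT) hcon
  obtain ⟨m, hm⟩ := Finite.exists_min fun v => toLex (clock W (T + T') v)
  have hconst : ∀ t ≥ T + T', ∀ v, clock W t v = clock W (T + T') v := by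
    intro t ht v
    refine Prod.ext ((hT t (by omega) v).trans (hT (T + T') (by omega) v).symm) ?_
    have := hT' (t - T) (by omega) v
    rwa [show T + (t - T) = t by omega] at this
  obtain ⟨t, ht, hσ⟩ := hW.fair m (T + T')
  have hc := (hconst (t + 1) (by omega) m).trans (hconst t ht m).symm
  rcases stay_or_move hW t m with ⟨-, -, h⟩ | ⟨-, hmove⟩
  · obtain ⟨u, hu⟩ := h hσ
    rw [hconst t ht, hconst t ht] at hu
    have := hm u
    rw [Prod.Lex.toLex_le_toLex] at this
    unfold Behind at hu
    omega
  · rw [hc] at hmove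
    generalize hd : clock W t m = d, W (t + 1) m = w at hmove
    cases hmove <;> simp [Prod.ext_iff] at hd

theorem exists_advance (hW : A.IsExecution G lab σ W) {T : ℕ}
    (hT : ∀ t ≥ T, ∀ v, (clock W t v).1 = (clock W T v).1) {v : V}
    (hv : ∀ M, ∃ t, M < (clock W (T + t) v).2) (p : ℕ) :
    ∃ t ≥ T, p ≤ (clock W t v).2 ∧ (∀ u, G.Adj v u → (clock W t u).1 = (clock W t v).1) ∧
      ¬A.Abdicates (W t v).cur := by
  obtain ⟨s, hs⟩ := hv p
  by_contra! hcon
  have hconst : ∀ t ≥ s, (clock W (T + t) v).2 = (clock W (T + s) v).2 := by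
    intro t ht
    induction t, ht using Nat.le_induction with
    | base => rfl
    | succ t ht ih =>
      have h1 := hT (T + t) (by omega) v
      have h2 := hT (T + t + 1) (by omega) v
      rw [← ih, ← add_assoc]
      rcases stay_or_move hW (T + t) v with ⟨-, h, -⟩ | ⟨-, hm⟩
      · rw [h]
      · generalize clock W (T + t + 1) v = c, W (T + t + 1) v = w at hm h2
        cases hm with
        | follow => dsimp only at h2; omega
        | abdicate => dsimp only at h2; omega
        | advance hC h => exact absurd (hcon (T + t) (by omega) (by omega) hC) h
  obtain ⟨t, ht⟩ := hv (clock W (T + s) v).2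
  rcases le_total s t with hst | hst
  · exact ht.ne' (hconst t hst)
  · exact ht.not_ge (phase_mono hW hT v hst)

/-- The simulation eventually reaches a last epoch, in which all nodes get through all phases
without abdicating. -/
theorem exists_last_epoch (hG : G.Connected) (hW : A.IsExecution G lab σ W)
    (hA : A.Achieves G lab Good) : ∃ e T, (∀ t ≥ T, ∀ v, (clock W t v).1 = e) ∧
      (∀ v, Monotone fun t => (clock W (T + t) v).2) ∧
      ∀ v p, ∃ t ≥ T, p ≤ (clock W t v).2 ∧ ¬A.Abdicates (W t v).cur := by
  have := hG.nonempty
  obtain ⟨T, hT⟩ := exists_forall_eq_of_monotone (f := fun v t => (clock W t v).1)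
    (monotone_epoch hW) fun v => ⟨Nat.card V, fun t => by
      have := ncard_leaderOf_add_epoch_le hW hA t v
      omega⟩
  obtain ⟨r, hr⟩ := exists_phase_unbounded hW hT
  have hall : ∀ v, (clock W T v).1 = (clock W T r).1 ∧
      ∀ M, ∃ t, M < (clock W (T + t) v).2 := by
    intro v
    induction (SimpleGraph.reachable_iff_reflTransGen r v).1 (hG.preconnected r v) with
    | refl => exact ⟨rfl, hr⟩
    | @tail v u _ hadj ih =>
      obtain ⟨t, ht, -, hC, -⟩ := exists_advance hW hT ih.2 0
      have hE := hC u hadj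
      rw [hT t ht, hT t ht] at hE
      refine ⟨hE.trans ih.1, fun M => ?_⟩
      obtain ⟨t, ht⟩ := ih.2 (M + 1)
      refine ⟨t, ?_⟩
      have hn := near_clock hW (T + t) hadj
      have h1 := hT (T + t) (by omega) v
      have h2 := hT (T + t) (by omega) u
      unfold Near at hn
      omega
  refine ⟨(clock W T r).1, T, fun t ht v => (hT t ht v).trans (hall v).1, phase_mono hW hT,
    fun v p => ?_⟩
  obtain ⟨t, ht, hp, -, h⟩ := exists_advance hW hT (hall v).2 p
  exact ⟨t, ht, hp, h⟩

/-- The simulation achieves what the synchronous algorithm does, since the run of the last epoch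
is simulated completely. -/
theorem eventually_good (hG : G.Connected) (hW : A.IsExecution G lab σ W)
    (hA : A.Achieves G lab Good) : ∃ T, ∀ t ≥ T, ∀ v, Good (W t v).cur := by
  have := hG.nonempty
  obtain ⟨e, T, hT, hmono, hunb⟩ := exists_last_epoch hG hW hA
  have hcur : ∀ t ≥ T, ∀ v, (W t v).cur = A.epochRun G lab W e (clock W t v).2 v := by
    intro t ht v
    rw [(cur_last_eq hW t v).1, hT t ht]
  obtain ⟨N, hN⟩ := hA.eventually_good _ (exists_leaderOf hW hA e) fun p v hab => by
    obtain ⟨t, ht, hp, h⟩ := hunb v p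
    rw [hcur t ht] at h
    exact h (hA.abdicates_mono _ _ _ v hp hab)
  choose f hf hf' using fun v => hunb v N
  refine ⟨T + ∑ v, f v, fun t ht v => ?_⟩
  rw [hcur t (by omega)]
  refine hN _ ((hf' v).1.trans ?_) v
  have h1 := Finset.single_le_sum (f := f) (fun _ _ => Nat.zero_le _) (Finset.mem_univ v)
  have h2 := hmono v (show f v - T ≤ t - T by omega)
  have h3 := hf v
  dsimp only at h2
  rwa [show T + (f v - T) = f v by omega, show T + (t - T) = t by omega] at h2

end Simulation

/-! ### The automaton -/

section Automaton

variable {l : ℕ} (a : Fin l → ℤ) (k : ℕ)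

/-- A bound on the values that occur in the averaging process: a small value, of absolute value at
most `2 * k`, may change by `2 * k` and then be doubled. -/
def valueBound : ℕ := 8 * k + ∑ i, (a i).natAbs

/-- The synchronous algorithm for the sign of the sum of the numbers `a i` over the nodes. A
refuted leader abdicates. -/
noncomputable def signAlgorithm : SyncAlgorithm (Fin l) (Cell (valueBound a k)) where
  init i leader := cellInit _ (a i) leader
  step := cellStep k
  Abdicates q := q.leader ∧ q.refuted

theorem signAlgorithm_achieves {V : Type*} [Fintype V] {G : SimpleGraph V} (hG : G.Connected)
    (hk : ∀ v, (nbrs G v).card ≤ k) (lab : V → Fin l) :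
    (signAlgorithm a k).Achieves G lab fun q => q.alarm ↔ ∑ v, a (lab v) < 0 := by
  have hrun : ∀ L : V → Prop, syncRun G (signAlgorithm a k).step
      (fun v => (signAlgorithm a k).init (lab v) (L v)) =
      idealRun G k (valueBound a k) (fun v => a (lab v)) L := fun _ => rfl
  have hB : 8 * k ≤ valueBound a k := Nat.le_add_right _ _
  have h₀ : ∀ v, -(valueBound a k : ℤ) ≤ a (lab v) ∧ a (lab v) ≤ valueBound a k := by
    intro v
    have := Finset.single_le_sum (f := fun i => (a i).natAbs) (fun _ _ => Nat.zero_le _)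
      (Finset.mem_univ (lab v))
    unfold valueBound
    omega
  constructor
  · intro L t v h
    exact (leader_idealRun t v).1 h.1
  · intro L s t v hst h
    exact ⟨(leader_idealRun t v).2 ((leader_idealRun s v).1 h.1), refuted_mono hst h.2⟩
  · intro L hL
    obtain ⟨D, hD⟩ := exists_isDistTo hG hL
    obtain ⟨r, hr, h⟩ := exists_leader_not_refuted (k := k) (B := valueBound a k)
      (x₀ := fun v => a (lab v)) hD hL
    exact ⟨r, hr, fun t ht => h t ht.2⟩
  · intro L hL h
    obtain ⟨D, hD⟩ := exists_isDistTo hG hL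
    exact eventually_alarm_iff hG hL
      (fun r hr t ht => h t r ⟨(leader_idealRun t r).2 hr, ht⟩) hD hk hB h₀

/-- The multiset with the given multiplicities. -/
noncomputable def ofCounts {S : Type} [Finite S] {n : ℕ} (N : S → Fin n) : Multiset S :=
  letI := Fintype.ofFinite S
  ∑ r, (N r : ℕ) • {r}

theorem count_ofCounts {S : Type} [Finite S] [DecidableEq S] {n : ℕ} (N : S → Fin n) (r : S) :
    (ofCounts N).count r = N r := by
  simp [ofCounts, Multiset.count_sum', Multiset.count_singleton]

/-- The machine that simulates the synchronous algorithm. Its counting bound exceeds the degrees,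
so that a node sees the whole multiset of the states of its neighbours. -/
noncomputable def signMachine : DistributedMachine (Fin l) where
  State := Station (Fin l) (Cell (valueBound a k))
  finite_state := inferInstance
  bound := k + 1
  one_le_bound := Nat.le_add_left 1 k
  init i := (signAlgorithm a k).start 0 True i
  trans q N := (signAlgorithm a k).simulate q (ofCounts N)
  accepting := {q | ¬q.cur.alarm}
  rejecting := {q | q.cur.alarm}
  disjoint := Set.disjoint_left.2 fun _ h h' => h h'

instance : Finite (signMachine a k).State := (signMachine a k).finite_state

variable {a k} {G : LabelledGraph.{u} (Fin l)} [Fintype G.V]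

theorem card_nbrs_le (hG : G ∈ LabelledGraph.degreeBounded (Fin l) k) (v : G.V) :
    (nbrs G.graph v).card ≤ k := by
  have h : (nbrs G.graph v : Set G.V) = G.graph.neighborSet v := by
    ext u
    simp
  rw [← Set.ncard_coe_finset, h]
  exact hG v

theorem ofCounts_neighbourhood (hk : ∀ v, (nbrs G.graph v).card ≤ k)
    (C : G.V → (signMachine a k).State) (v : G.V) :
    ofCounts ((signMachine a k).neighbourhood G C v) = (nbrs G.graph v).val.map C := by
  classical
  ext r
  have hcard : {w : G.V | G.graph.Adj v w ∧ C w = r}.ncard =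
      ((nbrs G.graph v).filter fun w => r = C w).card := by
    rw [← Set.ncard_coe_finset]
    congr 1
    ext w
    simp [eq_comm]
  rw [count_ofCounts, Multiset.count_map]
  change min _ (k + 1) = ((nbrs G.graph v).filter fun w => r = C w).card
  rw [hcard, min_eq_left]
  exact (Finset.card_filter_le _ _).trans ((hk v).trans (Nat.le_succ k))

theorem isExecution_run (hk : ∀ v, (nbrs G.graph v).card ≤ k) {σ : ℕ → Set G.V} {τ : ℕ → G.V}
    (hτ : ∀ t, σ t = {τ t}) (hσ : ∀ v n, ∃ t ≥ n, v ∈ σ t) :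
    (signAlgorithm a k).IsExecution G.graph G.label τ ((signMachine a k).run G σ) where
  zero _ := rfl
  selected t :=
    (if_pos (by rw [hτ]; rfl)).trans (congrArg ((signAlgorithm a k).simulate _)
      (ofCounts_neighbourhood hk ((signMachine a k).run G σ t) (τ t)))
  idle t v hv := if_neg (by rwa [hτ])
  fair v n := by
    obtain ⟨t, ht, hv⟩ := hσ v n
    rw [hτ] at hv
    exact ⟨t, ht, hv.symm⟩

theorem sum_label_eq :
    ∑ v, a (G.label v) = ∑ i, a i * (G.labelCount i : ℤ) := by
  classical
  rw [← Finset.sum_fiberwise Finset.univ G.label]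
  refine Finset.sum_congr rfl fun i _ => ?_
  have hcount : G.labelCount i = (Finset.univ.filter fun v => G.label v = i).card := by
    rw [LabelledGraph.labelCount, ← Set.ncard_coe_finset]
    congr 1
    ext v
    simp
  rw [Finset.sum_congr rfl fun v hv => by rw [(Finset.mem_filter.1 hv).2], Finset.sum_const,
    hcount, nsmul_eq_mul, mul_comm]

end Automaton

section Scheduling

/-- The exclusive scheduler that considers all schedules fair in which every node is selected
infinitely often. -/
def adversary (Λ : Type) : Scheduler.{u} Λ where
  selections G := {S | ∃ v : G.V, S = {v}}
  selections_cover _ v := ⟨{v}, ⟨v, rfl⟩, rfl⟩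
  fair G := {σ | (∀ t, ∃ v : G.V, σ t = {v}) ∧ ∀ v : G.V, ∀ n, ∃ t ≥ n, v ∈ σ t}
  permitted_of_fair _ _ h := h.1
  infinitely_often_of_fair _ _ h := h.2

theorem exists_fair_adversary {Λ : Type} (G : LabelledGraph.{u} Λ) :
    ∃ σ, σ ∈ (adversary Λ).fair G := by
  have := G.finite_nodes
  have := G.connected.nonempty
  obtain ⟨f, hf⟩ := exists_surjective_nat G.V
  -- every node is selected at infinitely many times `Nat.pair i n`
  refine ⟨fun t => {f t.unpair.1}, fun t => ⟨_, rfl⟩, fun v n => ?_⟩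
  obtain ⟨i, rfl⟩ := hf v
  exact ⟨Nat.pair i n, Nat.right_le_pair i n, by simp⟩

theorem not_accepting_of_rejecting {Λ : Type} {M : DistributedMachine Λ} {G : LabelledGraph.{u} Λ}
    {σ : ℕ → Set G.V} (h : M.RejectingRun G σ) : ¬M.AcceptingRun G σ := by
  rintro ⟨s, hs⟩
  obtain ⟨t, ht⟩ := h
  obtain ⟨v⟩ := G.connected.nonempty
  exact Set.disjoint_left.1 M.disjoint (hs (max s t) (le_max_left _ _) v)
    (ht (max s t) (le_max_right _ _) v)

end Scheduling

/-- Every fair run of the machine eventually shows the sign of the sum of the labels. -/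
theorem eventually_alarm_run {l : ℕ} {a : Fin l → ℤ} {k : ℕ} {G : LabelledGraph.{u} (Fin l)}
    (hG : G ∈ LabelledGraph.degreeBounded (Fin l) k) {σ : ℕ → Set G.V}
    (hσ : σ ∈ (adversary (Fin l)).fair G) :
    ∃ T, ∀ t ≥ T, ∀ v, (((signMachine a k).run G σ t v).cur.alarm ↔
      ∑ i, a i * (G.labelCount i : ℤ) < 0) := by
  have := G.finite_nodes
  cases nonempty_fintype G.V
  choose τ hτ using hσ.1
  have hk := card_nbrs_le hG
  rw [← sum_label_eq]
  exact eventually_good G.connected (isExecution_run hk hτ hσ.2)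
    (signAlgorithm_achieves a k G.connected hk G.label)

end HomogeneousThreshold

open HomogeneousThreshold in
theorem mainTheorem2 (l : ℕ) (a : Fin l → ℤ) (φ : (Fin l → ℕ) → Prop)
    (hφ : ∀ x : Fin l → ℕ, φ x ↔ 0 ≤ ∑ i, a i * (x i : ℤ)) (k : ℕ) :
    ∃ A : DistributedAutomaton (LabelledGraph.degreeBounded.{u} (Fin l) k),
      A.IsDAf ∧ A.Decides φ := by
  have hacc : ∀ G ∈ LabelledGraph.degreeBounded.{u} (Fin l) k, φ G.labelCount →
      ∀ σ ∈ (adversary (Fin l)).fair G, (signMachine a k).AcceptingRun G σ := by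
    intro G hG h σ hσ
    obtain ⟨T, hT⟩ := eventually_alarm_run (a := a) hG hσ
    exact ⟨T, fun t ht v hv => ((hφ _).1 h).not_gt ((hT t ht v).1 hv)⟩
  have hrej : ∀ G ∈ LabelledGraph.degreeBounded.{u} (Fin l) k, ¬φ G.labelCount →
      ∀ σ ∈ (adversary (Fin l)).fair G, (signMachine a k).RejectingRun G σ := by
    intro G hG h σ hσ
    obtain ⟨T, hT⟩ := eventually_alarm_run (a := a) hG hσ
    exact ⟨T, fun t ht v => (hT t ht v).2 (lt_of_not_ge fun h' => h ((hφ _).2 h'))⟩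
  refine ⟨⟨signMachine a k, adversary (Fin l), fun G hG => ?_⟩,
    ⟨fun _ => rfl, fun _ σ h₁ h₂ => ⟨h₁, h₂⟩⟩, fun G hG => ⟨?_, fun h => ?_⟩⟩
  · by_cases h : φ G.labelCount
    · exact .inl (hacc G hG h)
    · exact .inr (hrej G hG h)
  · rintro ⟨σ, hσ, h⟩
    by_contra hcon
    exact not_accepting_of_rejecting (hrej G hG hcon σ hσ) h
  · obtain ⟨σ, hσ⟩ := exists_fair_adversary G
    exact ⟨σ, hσ, hacc G hG h σ hσ⟩
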